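/- **Setting.** Let $m,d\ge 1$, let $(v_k,y_k)\in\mathbb R^d\times\mathbb R$ ($k=1,\dots,m$) be examples with labels, let $l$ be a loss such that each $z\mapsto l(z,y_k)$ is convex and twice continuously differentiable on $\mathbb R$, and let $\lambda>0$. The regularized GLM objective is $$f(x)=\frac1m\sum_{k=1}^m f_k(x),\qquad f_k(x)=l(\langle v_k,x\rangle,y_k)+\frac{\lambda}{2}\|x\|^2 ,\qquad x\in\mathbb R^d .$$ Assume $\nabla^2 f_k(x)\preceq L\,I$ for all $k,x$ with some constant $L$, and that $\nabla^2 f$ is Lipschitz. With $\beta_{\max}(x)=\max_k\lambda_{\max}(\nabla^2f_k(x))$ and $\alpha_{\min}(x)=\min_k\lambda_{\min}(\nabla^2f_k(x))$ put $$\hat\kappa_l=\sup_x\frac{\beta_{\max}(x)}{\lambda_{\min}(\nabla^2 f(x))},\qquad \hat\kappa_l^{\max}=\sup_x\frac{\beta_{\max}(x)}{\alpha_{\min}(x)} .$$ **Algorithm (LiSSA)** on an input $F=\frac1m\sum_kF_k$ with parameters $T_1,S_1,S_2,T$: let $x_1$ be the output of $T_1$ steps of a first-order method FO. For $t=1,\dots,T$: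 for each $i=1,\dots,S_1$ set $X_{[i,0]}=\nabla F(x_t)$ and, for $j=1,\dots,S_2$, draw $k$ uniformly from $\{1,\dots,m\}$, independently of all other draws, and set $X_{[i,j]}=\nabla F(x_t)+(I-\nabla^2F_k(x_t))X_{[i,j-1]}$; then $x_{t+1}=x_t-\frac1{S_1}\sum_iX_{[i,S_2]}$. Return $x_{T+1}$. Gradients and Hessian-vector products are computed from the GLM form. Time is counted with unit cost for each real arithmetic operation, stored vector entry, loop iteration, uniform draw of an index, and evaluation of the first or second derivative of some $l(\cdot,y_k)$. FO may be any (possibly randomized) procedure whose first $n$ steps take bounded time for every $n$, and which for every $\eta,\rho>0$ has a number of steps after which, with probability at least $1-\rho$, it has found an $\eta$-approximate minimizer of $f$. The input is $F=sf$ with a scaling constant $s>0$, which does not change the minimizer. **Claim.** There are universal constants $C,p$ such that for every $f$ as above: 0. gradient descent with step size $1/L$ from any starting point is an admissible FO; 1. there is a scaling $s>0$ such that, for every admissible FO, LiSSA on $sf$ has the guarantee (G) below with $\kappa=\hat\kappa_l$ and $\kappa^{\max}=\hat\kappa_l^{\max}$; 2. for every admissible FO, LiSSA on $f/L$ (that is,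 on $f$ itself when $L=1$) has the guarantee (G) with $\kappa=\sup_x \frac{L}{\lambda_{\min}(\nabla^2f(x))}$ and $\kappa^{\max}=\sup_x\frac{L}{\alpha_{\min}(x)}$. (G) For every $\delta\in(0,1)$ there are $T_1$, $S_1\ge 1$, $S_2\ge 1$ and $\varepsilon_0>0$ such that for every $\varepsilon\in(0,\varepsilon_0)$ there is $T$ for which LiSSA returns, with probability at least $1-\delta$, a point $x$ with $f(x)\le\min_{z} f(z)+\varepsilon$, and its total time, including the FO phase, is in every run at most $$C\Big(1+\ln\kappa+\ln d+\ln\tfrac1\delta\Big)^{p}\,\big(m+(\kappa^{\max})^2\,\kappa\big)\,d\,\ln\tfrac1\varepsilon .$$ -/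

import Mathlib

open scoped NNReal

noncomputable section

namespace Lissa

/-! ## Generalized linear models with an l2 regularizer -/

/-- Points of `ℝ^d` with the Euclidean norm. -/
abbrev Vec (d : ℕ) : Type := EuclideanSpace ℝ (Fin d)

/-- The data of a regularized GLM objective: the scalar loss `l(z, y)`, the examples `v_k`, their
labels `y_k` and the regularization parameter `lam`. -/
structure GLM (m d : ℕ) where
  loss : ℝ → ℝ → ℝ
  v : Fin m → Vec d
  y : Fin m → ℝ
  lam : ℝ

namespace GLM

variable {m d : ℕ}

/-- `f_k(x) = l(⟨v_k, x⟩, y_k) + (lam / 2) ‖x‖²`: the regularizer is included in every component. -/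
def component (P : GLM m d) (k : Fin m) (x : Vec d) : ℝ :=
  P.loss (inner ℝ (P.v k) x) (P.y k) + P.lam / 2 * ‖x‖ ^ 2

/-- `f(x) = (1 / m) ∑_k f_k(x)`. -/
def objective (P : GLM m d) (x : Vec d) : ℝ :=
  (1 / (m : ℝ)) * ∑ k, P.component k x

/-- The GLM whose objective is `s • f` and whose components are `s • f_k`. -/
def scale (P : GLM m d) (s : ℝ) : GLM m d where
  loss z y := s * P.loss z y
  v := P.v
  y := P.y
  lam := s * P.lam

end GLM

/-! ## Hessians and condition numbers -/

/-- The Hessian, as an operator: the derivative of the gradient. -/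
def hess {d : ℕ} (g : Vec d → ℝ) (x : Vec d) : Vec d →L[ℝ] Vec d :=
  fderiv ℝ (gradient g) x

/-- The largest eigenvalue of a symmetric operator. -/
def lamMax {d : ℕ} (A : Vec d →L[ℝ] Vec d) : ℝ :=
  sSup {μ : ℝ | Module.End.HasEigenvalue (A : Vec d →ₗ[ℝ] Vec d) μ}

/-- The smallest eigenvalue of a symmetric operator. -/
def lamMin {d : ℕ} (A : Vec d →L[ℝ] Vec d) : ℝ :=
  sInf {μ : ℝ | Module.End.HasEigenvalue (A : Vec d →ₗ[ℝ] Vec d) μ}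

namespace GLM

variable {m d : ℕ}

/-- `β_max(x) = max_k λ_max(∇² f_k(x))`. -/
def betaMax (P : GLM m d) (x : Vec d) : ℝ := ⨆ k, lamMax (hess (P.component k) x)

/-- `α_min(x) = min_k λ_min(∇² f_k(x))`. -/
def alphaMin (P : GLM m d) (x : Vec d) : ℝ := ⨅ k, lamMin (hess (P.component k) x)

/-- The local condition number `max_x β_max(x) / λ_min(∇² f(x))`. -/
def kappaLocal (P : GLM m d) : ℝ := ⨆ x, P.betaMax x / lamMin (hess P.objective x)

/-- The per-component local condition number `max_x β_max(x) / α_min(x)`. -/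
def kappaLocalMax (P : GLM m d) : ℝ := ⨆ x, P.betaMax x / P.alphaMin x

end GLM

/-! ## Randomized programs with a clock

Real-number arithmetic model: a program is a randomized computation that carries a clock. One unit
of time is charged for every arithmetic operation on reals, every stored entry of a vector, every
evaluation of the first or second derivative of a scalar loss `l(·, y_k)`, every random draw of an
index and every loop iteration. -/

/-- Randomized computations that carry a clock. -/
abbrev Prog (α : Type) : Type := StateT ℕ PMF α

/-- One unit of time passes. -/
def tick : Prog Unit := modify (· + 1)

/-- A primitive instruction with the result `a`, at unit cost. -/
def instr {α : Type} (a : α) : Prog α := do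
  tick
  pure a

def add (a b : ℝ) : Prog ℝ := instr (a + b)

def sub (a b : ℝ) : Prog ℝ := instr (a - b)

def mul (a b : ℝ) : Prog ℝ := instr (a * b)

def div (a b : ℝ) : Prog ℝ := instr (a / b)

/-- Evaluation of the derivative of `l(·, y_k)` at `z`. -/
def lossDeriv {m d : ℕ} (P : GLM m d) (k : Fin m) (z : ℝ) : Prog ℝ :=
  instr (deriv (fun w => P.loss w (P.y k)) z)

/-- Evaluation of the second derivative of `l(·, y_k)` at `z`. -/
def lossDerivTwo {m d : ℕ} (P : GLM m d) (k : Fin m) (z : ℝ) : Prog ℝ :=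
  instr (deriv (deriv (fun w => P.loss w (P.y k))) z)

/-- Draw an index from `[m]` uniformly at random, independently of everything drawn before. -/
def sample (m : ℕ) [NeZero m] : Prog (Fin m) := do
  tick
  StateT.lift (PMF.uniformOfFintype (Fin m))

/-- Repeat `body` for `n` iterations. -/
def loop {α : Type} (body : α → Prog α) : ℕ → α → Prog α
  | 0, a => pure a
  | n + 1, a => do
    tick
    let b ← body a
    loop body n b

/-- Run the entry programs in order and store their results in an array. -/
def fillArray : {n : ℕ} → (Fin n → Prog ℝ) → Prog (Fin n → ℝ)
  | 0, _ => pure Fin.elim0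
  | _ + 1, entry => do
    let a ← entry 0
    tick
    let r ← fillArray (fun i => entry i.succ)
    pure (Fin.cons a r)

variable {m d : ℕ}

/-- Compute a vector entry by entry. -/
def vec (entry : Fin d → Prog ℝ) : Prog (Vec d) := do
  let r ← fillArray entry
  pure (WithLp.toLp 2 r)

def vzero : Prog (Vec d) := vec fun _ => pure 0

def vadd (u w : Vec d) : Prog (Vec d) := vec fun i => add (u i) (w i)

def vsub (u w : Vec d) : Prog (Vec d) := vec fun i => sub (u i) (w i)

def vsmul (a : ℝ) (u : Vec d) : Prog (Vec d) := vec fun i => mul a (u i)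

/-- `a • u + w`. -/
def axpy (a : ℝ) (u w : Vec d) : Prog (Vec d) := do
  let r ← vsmul a u
  vadd r w

/-- The inner product, accumulated coordinate by coordinate. -/
def dot (u w : Vec d) : Prog ℝ :=
  (List.finRange d).foldlM (fun acc i => do
    tick
    let p ← mul (u i) (w i)
    add acc p) 0

/-- The full gradient `∇f(x) = (1 / m) ∑_k l'(⟨v_k, x⟩, y_k) v_k + lam x`. -/
def gradProg (P : GLM m d) (x : Vec d) : Prog (Vec d) := do
  let z ← vzero
  let g ← (List.finRange m).foldlM (fun acc k => do
    tick
    let t ← dot (P.v k) x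
    let a ← lossDeriv P k t
    axpy a (P.v k) acc) z
  let c ← div 1 (m : ℝ)
  let h ← vsmul c g
  axpy P.lam x h

/-- The Hessian-vector product `∇²f_k(x) w = l''(⟨v_k, x⟩, y_k) ⟨v_k, w⟩ v_k + lam w`. -/
def hessVec (P : GLM m d) (k : Fin m) (x w : Vec d) : Prog (Vec d) := do
  let t ← dot (P.v k) x
  let a ← lossDerivTwo P k t
  let b ← dot (P.v k) w
  let c ← mul a b
  let r ← vsmul P.lam w
  axpy c (P.v k) r

/-- One recursion step `X ↦ g + (I - ∇²f_k(x)) X` with a uniformly random `k`. -/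
def innerStep [NeZero m] (P : GLM m d) (x g X : Vec d) : Prog (Vec d) := do
  let k ← sample m
  let h ← hessVec P k x X
  let u ← vsub X h
  vadd g u

/-- One sampled Newton direction: `S₂` recursion steps, started at `X = g`. -/
def chain [NeZero m] (P : GLM m d) (x g : Vec d) (S₂ : ℕ) : Prog (Vec d) :=
  loop (innerStep P x g) S₂ g

/-- One step of the Newton phase: average `S₁` independent sampled directions and subtract. -/
def newtonStep [NeZero m] (P : GLM m d) (S₁ S₂ : ℕ) (x : Vec d) : Prog (Vec d) := do
  let g ← gradProg P x
  let z ← vzero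
  let acc ← loop (fun acc => do
    let X ← chain P x g S₂
    vadd acc X) S₁ z
  let c ← div 1 (S₁ : ℝ)
  let X ← vsmul c acc
  vsub x X

/-- The LiSSA algorithm: `T₁` steps of the first-order method `FO`, then `T` approximate Newton
steps. -/
def lissa [NeZero m] (P : GLM m d) (FO : ℕ → Prog (Vec d)) (T₁ S₁ S₂ T : ℕ) : Prog (Vec d) := do
  let x ← FO T₁
  loop (newtonStep P S₁ S₂) T x

/-- `n` steps of gradient descent with step size `η`, started at `x₀`. -/
def gradientDescent (P : GLM m d) (η : ℝ) (x₀ : Vec d) (n : ℕ) : Prog (Vec d) :=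
  loop (fun x => do
    let g ← gradProg P x
    let u ← vsmul η g
    vsub x u) n x₀

/-! ## Guarantees -/

/-- The joint law of the output and of the total time of a program started at time `0`. -/
def law {α : Type} (p : Prog α) : PMF (α × ℕ) := p.run 0

/-- Every possible run of the program takes time at most `B`. -/
def RunsWithin {α : Type} (p : Prog α) (B : ℝ) : Prop :=
  ∀ o ∈ (law p).support, (o.2 : ℝ) ≤ B

/-- With probability at least `1 - δ` the output `x` satisfies `f(x) ≤ f(z) + ε` for all `z`. -/
def FindsMin (f : Vec d → ℝ) (p : Prog (Vec d)) (ε δ : ℝ) : Prop :=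
  ENNReal.ofReal (1 - δ) ≤ (law p).toOuterMeasure {o | ∀ z, f o.1 ≤ f z + ε}

/-- A (possibly randomized) iterative method that reaches every accuracy with every probability
below one: its first `n` steps take bounded time, and a suitable number of steps suffices. -/
structure IsConvergentMethod (f : Vec d → ℝ) (FO : ℕ → Prog (Vec d)) : Prop where
  time : ∀ n, ∃ B : ℝ, RunsWithin (FO n) B
  finds : ∀ ε > 0, ∀ δ > 0, ∃ n, FindsMin f (FO n) ε δ

/-- LiSSA, run on the instance `Q` with the initial phase `FO`, solves `min f` for all small `ε` in
total time `C L^p (m + κmax² κ) d ln(1/ε)`, where `L = 1 + ln κ + ln d + ln(1/δ)`. Only the number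
`T` of Newton steps depends on `ε`. -/
def SolvesInTime [NeZero m] (C : ℝ) (p : ℕ) (f : Vec d → ℝ) (Q : GLM m d) (FO : ℕ → Prog (Vec d))
    (κ κmax : ℝ) : Prop :=
  ∀ δ : ℝ, 0 < δ → δ < 1 →
    ∃ T₁ S₁ S₂ : ℕ, 0 < S₁ ∧ 0 < S₂ ∧ ∃ ε₀ > 0, ∀ ε : ℝ, 0 < ε → ε < ε₀ →
      ∃ T : ℕ, FindsMin f (lissa Q FO T₁ S₁ S₂ T) ε δ ∧
        RunsWithin (lissa Q FO T₁ S₁ S₂ T)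
          (C * (1 + Real.log κ + Real.log d + Real.log (1 / δ)) ^ p
            * ((m + κmax ^ 2 * κ) * d * Real.log (1 / ε)))

end Lissa

end

noncomputable section

namespace Lissa

/-! ## Cost semantics of programs -/

/-! Everything is local at the minimizer `xs`. The parameters `T₁`, `S₁`, `S₂` may depend on `δ` and
on the instance, and only `T` on `ε`. The first phase can therefore be run until it lands, with
probability `1 - δ/2`, in a tiny ball around `xs`. Its time is a constant, absorbed into `ln(1/ε)`
by taking `ε₀` small. The remaining task is linear convergence of the Newton phase at a rate free of
condition numbers.

One Newton step: a chain is a random product of the contractions `1 - ∇²f_k`. Its mean follows the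
deterministic recursion `u ↦ g + (1 - H)u`, whose fixed point solves `H u = g`, so about `κ`
recursion steps make the bias a small fraction of the distance to `xs`. Each chain is bounded by a
multiple of `κmax ‖g‖`, so averaging about `κmax²` independent chains makes the variance equally
small. Near `xs` the squared distance thus halves in expectation
(`exists_radius_expect_newtonLaw_le`), at a cost of order `(m + κmax² κ) d`.

This halving is guaranteed only inside a ball, which a random step may leave. Treating the squared
distance as a supermartingale bounds the probability of escaping or of ending too far away by `V
(1/ρ + 2^(-T)/u)`, where `V` is the initial squared distance, `ρ` the squared radius and `u` the
target (`expect_iterLaw_indicator_le`). No union bound over steps is needed, so no logarithmic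
factors arise and the exponent `p = 0` suffices.

The condition numbers enter only through their values at `xs`, which the suprema dominate. Scaling
by the inverse of the curvature bound at `xs` makes every `1 - s ∇²f_k(xs)` a contraction. -/

/-- The program `p` has an output distributed as `q`, and takes exactly `B` units of time. -/
def Runs {α : Type} (p : Prog α) (q : PMF α) (B : ℕ) : Prop :=
  ∀ n, p.run n = q.map fun a => (a, n + B)

/-- The law of `n` steps of the Markov chain with transition law `r`. -/
def iterLaw {α : Type} (r : α → PMF α) : ℕ → α → PMF α
  | 0, a => PMF.pure a
  | n + 1, a => (r a).bind (iterLaw r n)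

section Runs

variable {α β : Type}

theorem runs_pure (a : α) : Runs (pure a) (PMF.pure a) 0 := fun n => by
  simp only [StateT.run_pure, PMF.pure_map]; rfl

/-- The cost `B'` must be the same for every intermediate result. The clock then stays deterministic
and decouples from the output law. -/
theorem Runs.bind {p : Prog α} {q : PMF α} {B : ℕ} {f : α → Prog β} {r : α → PMF β} {B' : ℕ}
    (hp : Runs p q B) (hf : ∀ a, Runs (f a) (r a) B') :
    Runs (p >>= f) (q.bind r) (B + B') := fun n => by
  rw [StateT.run_bind, hp n]
  change (q.map fun a => (a, n + B)).bind (fun o => (f o.1).run o.2) = _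
  rw [PMF.bind_map, PMF.map_bind]
  congr 1
  funext a
  simp only [Function.comp, hf a (n + B), add_assoc]

theorem Runs.bind_pure {p : Prog α} {a : α} {B : ℕ} {f : α → Prog β} {r : PMF β} {B' : ℕ}
    (hp : Runs p (PMF.pure a) B) (hf : Runs (f a) r B') : Runs (p >>= f) r (B + B') := fun n => by
  rw [StateT.run_bind, hp n, PMF.pure_map]
  change (PMF.pure (a, n + B)).bind (fun o => (f o.1).run o.2) = _
  rw [PMF.pure_bind, hf (n + B), add_assoc]

theorem Runs.cast {p : Prog α} {q q' : PMF α} {B B' : ℕ} (h : Runs p q B) (hq : q = q')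
    (hB : B = B') : Runs p q' B' := hq ▸ hB ▸ h

theorem runs_tick : Runs tick (PMF.pure ()) 1 := fun n => by
  simp only [PMF.pure_map]; rfl

theorem runs_instr (a : α) : Runs (instr a) (PMF.pure a) 1 :=
  Runs.cast (Runs.bind_pure runs_tick (runs_pure a)) rfl rfl

theorem runs_sample (m : ℕ) [NeZero m] :
    Runs (sample m) (PMF.uniformOfFintype (Fin m)) 1 := by
  refine runs_tick.bind_pure (B' := 0) fun n => ?_
  rw [StateT.run_lift]
  rfl

theorem runs_loop {body : α → Prog α} {r : α → PMF α} {B : ℕ} (h : ∀ a, Runs (body a) (r a) B)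
    (n : ℕ) (a : α) : Runs (loop body n a) (iterLaw r n a) (n * (B + 1)) := by
  induction n generalizing a with
  | zero => simpa using! runs_pure a
  | succ n ih =>
    exact Runs.cast (Runs.bind_pure runs_tick (Runs.bind (h a) ih)) rfl (by ring)

theorem runs_loop_pure {body : α → Prog α} {g : α → α} {B : ℕ}
    (h : ∀ a, Runs (body a) (PMF.pure (g a)) B) (n : ℕ) (a : α) :
    Runs (loop body n a) (PMF.pure (g^[n] a)) (n * (B + 1)) := by
  induction n generalizing a with
  | zero => simpa using! runs_pure a
  | succ n ih =>
    exact Runs.cast (Runs.bind_pure runs_tick (Runs.bind_pure (h a) (ih _))) rfl (by ring)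

theorem runs_foldlM {ι : Type} {step : α → ι → Prog α} {g : α → ι → α} {B : ℕ}
    (h : ∀ a i, Runs (step a i) (PMF.pure (g a i)) B) (l : List ι) (a : α) :
    Runs (l.foldlM step a) (PMF.pure (l.foldl g a)) (l.length * B) := by
  induction l generalizing a with
  | nil => simpa using! runs_pure a
  | cons i l ih =>
    rw [List.foldlM_cons]
    exact ((h a i).bind_pure (ih _)).cast rfl (by rw [List.length_cons]; ring)

theorem runs_fillArray {n : ℕ} {entry : Fin n → Prog ℝ} {w : Fin n → ℝ} {B : ℕ}
    (h : ∀ i, Runs (entry i) (PMF.pure (w i)) B) :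
    Runs (fillArray entry) (PMF.pure w) (n * (B + 1)) := by
  induction n with
  | zero =>
    rw [show w = Fin.elim0 from funext fun i => i.elim0]
    simpa using! runs_pure (Fin.elim0 : Fin 0 → ℝ)
  | succ n ih =>
    refine Runs.cast (Runs.bind_pure (h 0) (Runs.bind_pure runs_tick
      (Runs.bind_pure (ih fun i => h i.succ) (runs_pure _)))) ?_ (by ring)
    exact congrArg _ (Fin.cons_self_tail w)

end Runs

theorem foldl_add_eq_sum {V : Type} [AddCommMonoid V] {n : ℕ} (F : Fin n → V) :
    (List.finRange n).foldl (fun acc i => acc + F i) 0 = ∑ i, F i := by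
  have h : ∀ (l : List (Fin n)) (a : V),
      l.foldl (fun acc i => acc + F i) a = a + (l.map F).sum := by
    intro l
    induction l with
    | nil => simp
    | cons i l ih => intro a; simp [ih, add_assoc]
  rw [h, zero_add, Fin.sum_univ_def]

/-! ### Values and exact costs of the vector operations -/

section Vectors

variable {m d : ℕ}

theorem runs_vec {entry : Fin d → Prog ℝ} {w : Vec d} {B : ℕ}
    (h : ∀ i, Runs (entry i) (PMF.pure (w i)) B) :
    Runs (vec entry) (PMF.pure w) (d * (B + 1)) :=
  Runs.cast (Runs.bind_pure (runs_fillArray h) (runs_pure _)) rfl rfl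

theorem runs_vzero : Runs (vzero : Prog (Vec d)) (PMF.pure 0) d :=
  Runs.cast (runs_vec (B := 0) fun _ => runs_pure _) rfl (by ring)

theorem runs_vadd (u w : Vec d) : Runs (vadd u w) (PMF.pure (u + w)) (d * 2) :=
  runs_vec fun _ => runs_instr _

theorem runs_vsub (u w : Vec d) : Runs (vsub u w) (PMF.pure (u - w)) (d * 2) :=
  runs_vec fun _ => runs_instr _

theorem runs_vsmul (a : ℝ) (u : Vec d) : Runs (vsmul a u) (PMF.pure (a • u)) (d * 2) :=
  runs_vec fun _ => runs_instr _

theorem runs_axpy (a : ℝ) (u w : Vec d) : Runs (axpy a u w) (PMF.pure (a • u + w)) (d * 4) :=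
  Runs.cast (Runs.bind_pure (runs_vsmul a u) (runs_vadd _ w)) rfl (by ring)

theorem runs_dot (u w : Vec d) : Runs (dot u w) (PMF.pure (inner ℝ u w)) (d * 3) := by
  have := runs_foldlM (step := fun acc i => do
      tick
      let p ← mul (u i) (w i)
      add acc p) (g := fun acc i => acc + u i * w i) (B := 3)
    (fun a i => Runs.cast (Runs.bind_pure runs_tick
      (Runs.bind_pure (runs_instr (u i * w i)) (runs_instr _))) rfl rfl)
    (List.finRange d) 0
  rw [foldl_add_eq_sum, List.length_finRange] at this
  refine this.cast ?_ rfl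
  rw [PiLp.inner_apply]
  congr 2
  funext i
  simp [mul_comm]

end Vectors

namespace GLM

variable {m d : ℕ}

/-- The gradient of the objective, from the derivatives of the losses. -/
def grad (P : GLM m d) (x : Vec d) : Vec d :=
  P.lam • x + (1 / (m : ℝ)) •
    ∑ k, deriv (fun w => P.loss w (P.y k)) (inner ℝ (P.v k) x) • P.v k

/-- The Hessian of a component, from the second derivative of the loss. -/
def compHess (P : GLM m d) (k : Fin m) (x : Vec d) : Vec d →L[ℝ] Vec d :=
  deriv (deriv fun w => P.loss w (P.y k)) (inner ℝ (P.v k) x) •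
    (innerSL ℝ (P.v k)).smulRight (P.v k) + P.lam • ContinuousLinearMap.id ℝ (Vec d)

end GLM

/-! ### Laws and exact costs of gradients, chains and Newton steps -/

section Costs

variable {m d : ℕ}

theorem runs_gradProg (P : GLM m d) (x : Vec d) :
    Runs (gradProg P x) (PMF.pure (P.grad x)) (d + (m * (d * 7 + 2) + (1 + (d * 2 + d * 4)))) := by
  have h := runs_foldlM (step := fun acc k => do
      tick
      let t ← dot (P.v k) x
      let a ← lossDeriv P k t
      axpy a (P.v k) acc)
    (g := fun acc k => acc + deriv (fun w => P.loss w (P.y k)) (inner ℝ (P.v k) x) • P.v k)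
    (B := d * 7 + 2)
    (fun a k => Runs.cast (Runs.bind_pure runs_tick (Runs.bind_pure (runs_dot (P.v k) x)
      (Runs.bind_pure (runs_instr _) (runs_axpy _ (P.v k) a))))
      (by rw [add_comm]) (by ring))
    (List.finRange m) 0
  rw [foldl_add_eq_sum, List.length_finRange] at h
  exact Runs.bind_pure runs_vzero (Runs.bind_pure h (Runs.bind_pure (runs_instr _)
    (Runs.bind_pure (runs_vsmul _ _) (runs_axpy _ _ _))))

theorem runs_hessVec (P : GLM m d) (k : Fin m) (x w : Vec d) :
    Runs (hessVec P k x w) (PMF.pure (P.compHess k x w)) (d * 12 + 2) := by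
  refine Runs.cast (Runs.bind_pure (runs_dot (P.v k) x) (Runs.bind_pure (runs_instr _)
    (Runs.bind_pure (runs_dot (P.v k) w) (Runs.bind_pure (runs_instr _)
      (Runs.bind_pure (runs_vsmul _ _) (runs_axpy _ _ _)))))) ?_ (by ring)
  simp [GLM.compHess, mul_smul]

theorem runs_gradientDescent (P : GLM m d) (η : ℝ) (x₀ : Vec d) (n : ℕ) :
    ∃ B, Runs (gradientDescent P η x₀ n) (PMF.pure ((fun x => x - η • P.grad x)^[n] x₀)) B :=
  ⟨_, runs_loop_pure (fun x => Runs.bind_pure (runs_gradProg P x)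
    (Runs.bind_pure (runs_vsmul η _) (runs_vsub x _))) n x₀⟩

variable [NeZero m]

/-- The law of one recursion step of a chain. -/
def stepLaw (P : GLM m d) (x g X : Vec d) : PMF (Vec d) :=
  (PMF.uniformOfFintype (Fin m)).bind fun k => PMF.pure (g + (X - P.compHess k x X))

/-- The law of adding one sampled Newton direction to an accumulator. -/
def accLaw (P : GLM m d) (S₂ : ℕ) (x acc : Vec d) : PMF (Vec d) :=
  (iterLaw (stepLaw P x (P.grad x)) S₂ (P.grad x)).bind fun X => PMF.pure (acc + X)

/-- The law of one step of the Newton phase. -/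
def newtonLaw (P : GLM m d) (S₁ S₂ : ℕ) (x : Vec d) : PMF (Vec d) :=
  (iterLaw (accLaw P S₂ x) S₁ 0).bind fun acc => PMF.pure (x - (1 / (S₁ : ℝ)) • acc)

theorem runs_chain (P : GLM m d) (x g : Vec d) (S₂ : ℕ) :
    Runs (chain P x g S₂) (iterLaw (stepLaw P x g) S₂ g) (S₂ * (d * 16 + 4)) :=
  Runs.cast (runs_loop (fun X => Runs.bind (runs_sample m) fun k =>
    Runs.bind_pure (runs_hessVec P k x X) (Runs.bind_pure (runs_vsub X _) (runs_vadd g _))) S₂ g)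
    rfl (by ring)

theorem runs_newtonStep (P : GLM m d) (S₁ S₂ : ℕ) (x : Vec d) :
    Runs (newtonStep P S₁ S₂ x) (newtonLaw P S₁ S₂ x)
      (m * (d * 7 + 2) + S₁ * (S₂ * (d * 16 + 4) + d * 2 + 1) + (d * 12 + 2)) := by
  refine Runs.cast (Runs.bind_pure (runs_gradProg P x) (Runs.bind_pure runs_vzero (Runs.bind
    (runs_loop (r := accLaw P S₂ x)
      (fun acc => Runs.bind (runs_chain P x _ S₂) fun X => runs_vadd acc X) S₁ 0)
    fun acc => Runs.bind_pure (runs_instr _)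
      (Runs.bind_pure (runs_vsmul _ acc) (runs_vsub x _))))) rfl ?_
  ring

theorem runs_newtonPhase (P : GLM m d) (S₁ S₂ T : ℕ) (x : Vec d) :
    Runs (loop (newtonStep P S₁ S₂) T x) (iterLaw (newtonLaw P S₁ S₂) T x)
      (T * (m * (d * 7 + 2) + S₁ * (S₂ * (d * 16 + 4) + d * 2 + 1) + (d * 12 + 2) + 1)) :=
  runs_loop (runs_newtonStep P S₁ S₂) T x

end Costs

open scoped ENNReal

/-! ## Expectations -/

section Expectation

variable {α β : Type}

/-- The expectation of a nonnegative function. -/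
def expect (q : PMF α) (φ : α → ℝ≥0∞) : ℝ≥0∞ := ∑' a, q a * φ a

theorem expect_pure (a : α) (φ : α → ℝ≥0∞) : expect (PMF.pure a) φ = φ a := by
  rw [expect, tsum_eq_single a fun b hb => by simp [PMF.pure_apply, hb]]
  simp

theorem expect_bind (q : PMF α) (r : α → PMF β) (φ : β → ℝ≥0∞) :
    expect (q.bind r) φ = expect q fun a => expect (r a) φ := by
  simp only [expect, PMF.bind_apply, ← ENNReal.tsum_mul_right, ← ENNReal.tsum_mul_left]
  rw [ENNReal.tsum_comm]
  simp only [mul_assoc]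

theorem expect_map (q : PMF α) (f : α → β) (φ : β → ℝ≥0∞) :
    expect (q.map f) φ = expect q (φ ∘ f) := by
  rw [PMF.map, expect_bind]
  simp only [Function.comp, expect_pure]
  rfl

theorem expect_mono (q : PMF α) {φ ψ : α → ℝ≥0∞} (h : ∀ a, φ a ≤ ψ a) :
    expect q φ ≤ expect q ψ :=
  ENNReal.tsum_le_tsum fun a => mul_le_mul_right (h a) _

theorem expect_const (q : PMF α) (c : ℝ≥0∞) : (expect q fun _ => c) = c := by
  rw [expect, ENNReal.tsum_mul_right, q.tsum_coe, one_mul]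

theorem expect_mul_const (q : PMF α) (φ : α → ℝ≥0∞) (c : ℝ≥0∞) :
    (expect q fun a => φ a * c) = expect q φ * c := by
  simp only [expect, ← ENNReal.tsum_mul_right, mul_assoc]

theorem expect_add (q : PMF α) (φ ψ : α → ℝ≥0∞) :
    (expect q fun a => φ a + ψ a) = expect q φ + expect q ψ := by
  simp only [expect, mul_add, ENNReal.tsum_add]

theorem expect_indicator (q : PMF α) (s : Set α) :
    expect q (s.indicator 1) = q.toOuterMeasure s := by
  rw [expect, PMF.toOuterMeasure_apply]
  congr 1
  funext a
  by_cases h : a ∈ s <;> simp [h]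

theorem expect_indicator_add_compl (q : PMF α) (s : Set α) :
    expect q (s.indicator 1) + expect q (sᶜ.indicator 1) = 1 := by
  rw [← expect_add, ← expect_const q 1]
  congr 1
  funext a
  by_cases h : a ∈ s <;> simp [h]

/-- A Markov chain that halves a potential `V` in expectation as long as `V ≤ ρ` is unlikely to end
with a large value of `V`. -/
theorem expect_iterLaw_indicator_le {r : α → PMF α} {V : α → ℝ≥0∞} {ρ u : ℝ≥0∞}
    (hρ₀ : ρ ≠ 0) (hρ : ρ ≠ ⊤) (hu₀ : u ≠ 0) (hu : u ≠ ⊤)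
    (h : ∀ a, V a ≤ ρ → expect (r a) V ≤ V a * 2⁻¹) (n : ℕ) (a : α) :
    expect (iterLaw r n a) ({b | u < V b}.indicator 1) ≤ V a * (ρ⁻¹ + 2⁻¹ ^ n * u⁻¹) := by
  induction n generalizing a with
  | zero =>
    rw [iterLaw, expect_pure, pow_zero, one_mul]
    by_cases ha : u < V a
    -- Markov's inequality: `1 ≤ V a / u` on the bad event.
    · rw [Set.indicator_of_mem (by exact ha)]
      calc (1 : ℝ≥0∞) = u * u⁻¹ := (ENNReal.mul_inv_cancel hu₀ hu).symm
        _ ≤ V a * (ρ⁻¹ + u⁻¹) := mul_le_mul' ha.le le_add_self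
    · rw [Set.indicator_of_notMem (by exact ha)]
      exact bot_le
  | succ n ih =>
    by_cases ha : V a ≤ ρ
    · rw [iterLaw, expect_bind]
      calc _ ≤ expect (r a) fun b => V b * (ρ⁻¹ + 2⁻¹ ^ n * u⁻¹) := expect_mono _ ih
        _ = expect (r a) V * (ρ⁻¹ + 2⁻¹ ^ n * u⁻¹) := expect_mul_const _ _ _
        _ ≤ V a * 2⁻¹ * (ρ⁻¹ + 2⁻¹ ^ n * u⁻¹) := mul_le_mul_left (h a ha) _
        _ = V a * (2⁻¹ * ρ⁻¹ + 2⁻¹ ^ (n + 1) * u⁻¹) := by ring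
        _ ≤ V a * (ρ⁻¹ + 2⁻¹ ^ (n + 1) * u⁻¹) := by
          gcongr
          calc 2⁻¹ * ρ⁻¹ ≤ 1 * ρ⁻¹ := mul_le_mul_left (by simp) _
            _ = ρ⁻¹ := one_mul _
    -- Outside the region `V ≤ ρ` nothing is known about the chain, but there `V a / ρ ≥ 1` already
    -- bounds any probability. The term `ρ⁻¹` thus pays for all escapes.
    · calc _ ≤ expect (iterLaw r (n + 1) a) fun _ => 1 :=
            expect_mono _ fun b => Set.indicator_le_self' (fun _ _ => bot_le) b
        _ = ρ * ρ⁻¹ := by rw [expect_const, ENNReal.mul_inv_cancel hρ₀ hρ]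
        _ ≤ _ := mul_le_mul' (not_le.mp ha).le le_self_add

end Expectation

/-! ## Averages over finite types -/

section Average

variable {Ω Ω' V W : Type} [Fintype Ω] [Fintype Ω']
  [NormedAddCommGroup V] [NormedSpace ℝ V] [NormedAddCommGroup W] [NormedSpace ℝ W]

/-- The average of a family of vectors. -/
def avg (f : Ω → V) : V := (Fintype.card Ω : ℝ)⁻¹ • ∑ i, f i

theorem avg_add (f g : Ω → V) : (avg fun i => f i + g i) = avg f + avg g := by
  simp only [avg, Finset.sum_add_distrib, smul_add]

theorem avg_sub (f g : Ω → V) : (avg fun i => f i - g i) = avg f - avg g := by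
  simp only [avg, Finset.sum_sub_distrib, smul_sub]

theorem avg_const [Nonempty Ω] (v : V) : (avg fun _ : Ω => v) = v := by
  have : (Fintype.card Ω : ℝ) ≠ 0 := by exact_mod_cast Fintype.card_ne_zero
  rw [avg, Finset.sum_const, Finset.card_univ, ← Nat.cast_smul_eq_nsmul ℝ, smul_smul,
    inv_mul_cancel₀ this, one_smul]

theorem map_avg (A : V →L[ℝ] W) (f : Ω → V) : A (avg f) = avg fun i => A (f i) := by
  simp only [avg, map_smul, map_sum]

theorem avg_apply (A : Ω → V →L[ℝ] W) (v : V) : avg A v = avg fun i => A i v := by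
  simp [avg]

theorem avg_prod (f : Ω × Ω' → V) : avg f = avg fun i => avg fun j => f (i, j) := by
  simp only [avg, Fintype.card_prod, Nat.cast_mul, mul_inv, ← Finset.smul_sum, smul_smul,
    Fintype.sum_prod_type]

theorem avg_mono {f g : Ω → ℝ} (h : ∀ i, f i ≤ g i) : avg f ≤ avg g :=
  mul_le_mul_of_nonneg_left (Finset.sum_le_sum fun i _ => h i) (by positivity)

theorem avg_nonneg {f : Ω → ℝ} (h : ∀ i, 0 ≤ f i) : 0 ≤ avg f :=
  mul_nonneg (by positivity) (Finset.sum_nonneg fun i _ => h i)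

/-- Passage from `ℝ≥0∞`-valued expectations to real averages, where signed and vector-valued means
are available. -/
theorem expect_uniform [Nonempty Ω] {f : Ω → ℝ} (h : ∀ i, 0 ≤ f i) :
    (expect (PMF.uniformOfFintype Ω) fun i => ENNReal.ofReal (f i)) = ENNReal.ofReal (avg f) := by
  have : (0 : ℝ) < Fintype.card Ω := by exact_mod_cast Fintype.card_pos
  rw [expect, tsum_fintype, avg, smul_eq_mul, ENNReal.ofReal_mul (by positivity),
    ENNReal.ofReal_sum_of_nonneg fun i _ => h i, Finset.mul_sum, ENNReal.ofReal_inv_of_pos this,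
    ENNReal.ofReal_natCast]
  simp only [PMF.uniformOfFintype_apply]

/-- Expanding the square, the cross term averages to the one for the mean of `Z`. The variance is
bounded by the second moment, which is at most `R²`. -/
theorem avg_norm_add_sq_le {E : Type} [NormedAddCommGroup E] [InnerProductSpace ℝ E] [Nonempty Ω]
    (c : E) {Z : Ω → E} {R : ℝ} (h : ∀ i, ‖Z i‖ ≤ R) :
    (avg fun i => ‖c + Z i‖ ^ 2) ≤ ‖c + avg Z‖ ^ 2 + R ^ 2 := by
  have h₁ : (avg fun i => ‖c + Z i‖ ^ 2) ≤ avg fun i => ‖c‖ ^ 2 + 2 * inner ℝ c (Z i) + R ^ 2 :=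
    avg_mono fun i => by
      rw [norm_add_sq_real]
      gcongr
      exact h i
  have h₂ : (avg fun i => 2 * inner ℝ c (Z i)) = 2 * inner ℝ c (avg Z) := by
    simpa using! (map_avg ((2 : ℝ) • innerSL ℝ c) Z).symm
  rw [avg_add, avg_add, avg_const, avg_const, h₂] at h₁
  rw [norm_add_sq_real]
  nlinarith [sq_nonneg ‖avg Z‖]

/-- Affine maps commute with averages. -/
theorem iterate_avg [Nonempty Ω] (B : V →L[ℝ] V) (g : V) (n : ℕ) (f : Ω → V) :
    (fun u => g + B u)^[n] (avg f) = avg fun i => (fun u => g + B u)^[n] (f i) := by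
  induction n generalizing f with
  | zero => rfl
  | succ n ih =>
    simp only [Function.iterate_succ, Function.comp_apply]
    rw [← ih, avg_add, avg_const, map_avg]

end Average

/-! ## The moments of a Newton step -/

section Moments

variable {m d : ℕ} [NeZero m]

/-- A chain is a function of finitely many uniform random choices, is bounded, and its mean evolves
by the mean recursion. -/
theorem exists_chain_representation (P : GLM m d) (x g : Vec d) {a : ℝ} (ha : 0 < a)
    (hA : ∀ k, ‖1 - P.compHess k x‖ ≤ 1 - a) (n : ℕ) :
    ∃ (Ω : Type) (_ : Fintype Ω) (_ : Nonempty Ω) (Z : Vec d → Ω → Vec d),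
      (∀ X (φ : Vec d → ℝ), (∀ y, 0 ≤ φ y) →
        (expect (iterLaw (stepLaw P x g) n X) fun y => ENNReal.ofReal (φ y)) =
          ENNReal.ofReal (avg fun i => φ (Z X i))) ∧
      (∀ X, ‖X‖ ≤ ‖g‖ / a → ∀ i, ‖Z X i‖ ≤ ‖g‖ / a) ∧
      ∀ X, avg (Z X) = (fun u => g + (1 - avg fun k => P.compHess k x) u)^[n] X := by
  induction n with
  | zero =>
    refine ⟨Unit, inferInstance, inferInstance, fun X _ => X, fun X φ _ => ?_, fun X hX _ => hX,
      fun X => avg_const X⟩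
    rw [iterLaw, expect_pure, avg_const]
  | succ n ih =>
    obtain ⟨Ω, _, _, Z, h₁, h₂, h₃⟩ := ih
    -- The first draw is independent of the later ones, so it becomes a separate factor of the
    -- sample space.
    refine ⟨Fin m × Ω, inferInstance, inferInstance,
      fun X p => Z (g + (X - P.compHess p.1 x X)) p.2, fun X φ hφ => ?_, fun X hX p => ?_,
      fun X => ?_⟩
    · rw [iterLaw, expect_bind, stepLaw, expect_bind]
      simp only [expect_pure, h₁ _ φ hφ]
      rw [expect_uniform fun k => avg_nonneg fun i => hφ _, avg_prod]
    · refine h₂ _ ?_ _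
      have h₄ : ‖X - P.compHess p.1 x X‖ ≤ (1 - a) * (‖g‖ / a) := by
        calc ‖X - P.compHess p.1 x X‖ = ‖(1 - P.compHess p.1 x) X‖ := by simp
          _ ≤ ‖1 - P.compHess p.1 x‖ * ‖X‖ := ContinuousLinearMap.le_opNorm _ _
          _ ≤ _ := mul_le_mul (hA p.1) hX (norm_nonneg _) ((norm_nonneg _).trans (hA p.1))
      -- The radius `‖g‖ / a` is the fixed point of `R ↦ ‖g‖ + (1 - a) R`, so the ball is invariant
      -- under every draw.
      calc _ ≤ ‖g‖ + (1 - a) * (‖g‖ / a) := (norm_add_le _ _).trans (by gcongr)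
        _ = ‖g‖ / a := by field_simp; ring
    · rw [avg_prod]
      simp only [h₃]
      rw [← iterate_avg, avg_add, avg_const, avg_sub, avg_const, ← avg_apply,
        Function.iterate_succ, Function.comp_apply]
      simp

/-- Each fresh chain moves the centre by its mean and, being independent of the accumulator, adds at
most `R²` with `R = ‖∇f‖ / a`. The second moments therefore add up linearly in `n`. -/
theorem expect_accLaw_le (P : GLM m d) (x : Vec d) {a : ℝ} (ha : 0 < a) (ha₁ : a ≤ 1)
    (hA : ∀ k, ‖1 - P.compHess k x‖ ≤ 1 - a) (S₂ n : ℕ) (c w : Vec d) :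
    (expect (iterLaw (accLaw P S₂ x) n c) fun y => ENNReal.ofReal (‖y - w‖ ^ 2)) ≤
      ENNReal.ofReal (‖c + (n : ℝ) •
        (fun u => P.grad x + (1 - avg fun k => P.compHess k x) u)^[S₂] (P.grad x) - w‖ ^ 2 +
          n * (‖P.grad x‖ / a) ^ 2) := by
  obtain ⟨Ω, _, _, Z, h₁, h₂, h₃⟩ := exists_chain_representation P x (P.grad x) ha hA S₂
  rw [← h₃]
  set μ := avg (Z (P.grad x)) with hμ
  set R := ‖P.grad x‖ / a with hR
  have hZ := h₂ (P.grad x) (by rw [le_div_iff₀ ha]; nlinarith [norm_nonneg (P.grad x)])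
  induction n generalizing c with
  | zero => simp [iterLaw, expect_pure]
  | succ n ih =>
    rw [iterLaw, expect_bind, accLaw, expect_bind]
    simp only [expect_pure]
    refine (expect_mono _ fun X => ih (c + X)).trans ?_
    rw [h₁ _ (fun X => ‖c + X + (n : ℝ) • μ - w‖ ^ 2 + n * R ^ 2) fun y => by positivity]
    refine ENNReal.ofReal_le_ofReal ?_
    rw [avg_add, avg_const]
    have h₄ := avg_norm_add_sq_le (c + (n : ℝ) • μ - w) hZ
    rw [← hμ] at h₄
    have h₅ : c + (n : ℝ) • μ - w + μ = c + ((n + 1 : ℕ) : ℝ) • μ - w := by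
      push_cast; module
    have h₆ : (fun i => ‖c + Z (P.grad x) i + (n : ℝ) • μ - w‖ ^ 2) =
        fun i => ‖c + (n : ℝ) • μ - w + Z (P.grad x) i‖ ^ 2 := by
      funext i; congr 2; abel
    rw [h₅] at h₄
    rw [h₆]
    push_cast at h₄ ⊢
    linarith

/-- Bias and variance of a sampled Newton step. -/
theorem expect_newtonLaw_le (P : GLM m d) (x y : Vec d) {a : ℝ} (ha : 0 < a) (ha₁ : a ≤ 1)
    (hA : ∀ k, ‖1 - P.compHess k x‖ ≤ 1 - a) {S₁ : ℕ} (hS₁ : 0 < S₁) (S₂ : ℕ) :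
    (expect (newtonLaw P S₁ S₂ x) fun z => ENNReal.ofReal (‖z - y‖ ^ 2)) ≤
      ENNReal.ofReal (‖(fun u => P.grad x + (1 - avg fun k => P.compHess k x) u)^[S₂] (P.grad x) -
        (x - y)‖ ^ 2 + (‖P.grad x‖ / a) ^ 2 / S₁) := by
  have hS : (0 : ℝ) < S₁ := by exact_mod_cast hS₁
  set μ := (fun u => P.grad x + (1 - avg fun k => P.compHess k x) u)^[S₂] (P.grad x) with hμ
  rw [newtonLaw, expect_bind]
  simp only [expect_pure]
  have h₁ : ∀ acc : Vec d, ENNReal.ofReal (‖x - (1 / (S₁ : ℝ)) • acc - y‖ ^ 2) =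
      ENNReal.ofReal (‖acc - (S₁ : ℝ) • (x - y)‖ ^ 2) * ENNReal.ofReal ((1 / (S₁ : ℝ)) ^ 2) := by
    intro acc
    rw [← ENNReal.ofReal_mul (by positivity), ← mul_pow,
      show x - (1 / (S₁ : ℝ)) • acc - y = -((1 / (S₁ : ℝ)) • (acc - (S₁ : ℝ) • (x - y))) by
        rw [smul_sub, smul_smul, one_div_mul_cancel hS.ne', one_smul]; abel,
      norm_neg, norm_smul, Real.norm_of_nonneg (by positivity), mul_comm]
  simp only [h₁]
  rw [expect_mul_const]
  refine (mul_le_mul_left (expect_accLaw_le P x ha ha₁ hA S₂ S₁ 0 _) _).trans ?_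
  rw [← ENNReal.ofReal_mul (by positivity), ← hμ]
  refine ENNReal.ofReal_le_ofReal (le_of_eq ?_)
  rw [zero_add, ← smul_sub, norm_smul, Real.norm_of_nonneg hS.le]
  field_simp

/-- The mean recursion converges to the solution of the linear system. -/
theorem norm_iterate_sub_le {E : Type} [NormedAddCommGroup E] [NormedSpace ℝ E] (A : E →L[ℝ] E)
    {b τ : ℝ} (hb : 0 < b) (hA : ‖1 - A‖ ≤ 1 - b) {g e : E} (hg : ‖g - A e‖ ≤ τ) (n : ℕ) (X : E) :
    ‖(fun u => g + (1 - A) u)^[n] X - e‖ ≤ τ / b + (1 - b) ^ n * ‖X - e‖ := by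
  have hb₁ : 0 ≤ 1 - b := (norm_nonneg _).trans hA
  have hτ : 0 ≤ τ := (norm_nonneg _).trans hg
  induction n with
  | zero => simp; positivity
  | succ n ih =>
    rw [Function.iterate_succ_apply']
    set u := (fun u => g + (1 - A) u)^[n] X
    calc ‖g + (1 - A) u - e‖ = ‖(g - A e) + (1 - A) (u - e)‖ := by
          congr 1; simp; abel
      -- `τ / b` is the fixed point of `t ↦ τ + (1 - b) t`.
      _ ≤ τ + (1 - b) * (τ / b + (1 - b) ^ n * ‖X - e‖) := by
          refine (norm_add_le _ _).trans (add_le_add hg ?_)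
          exact ((1 - A).le_opNorm _).trans (mul_le_mul hA ih (norm_nonneg _) hb₁)
      _ = _ := by field_simp; ring

end Moments

/-! ## Gradients and Hessians of generalized linear models -/

section

variable {Ω E V : Type} [Fintype Ω] [NormedAddCommGroup E] [NormedSpace ℝ E]
  [NormedAddCommGroup V] [NormedSpace ℝ V]

theorem hasFDerivAt_avg {f : Ω → E → V} {f' : Ω → E →L[ℝ] V} {x : E}
    (h : ∀ i, HasFDerivAt (f i) (f' i) x) :
    HasFDerivAt (fun y => avg fun i => f i y) (avg f') x :=
  (HasFDerivAt.fun_sum fun i (_ : i ∈ Finset.univ) => h i).fun_const_smul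
    (Fintype.card Ω : ℝ)⁻¹

theorem continuous_avg {X : Type} [TopologicalSpace X] {f : Ω → X → V} (h : ∀ i, Continuous (f i)) :
    Continuous fun y => avg fun i => f i y :=
  Continuous.const_smul (continuous_finsetSum _ fun i _ => h i) (Fintype.card Ω : ℝ)⁻¹

end

namespace GLM

variable {m d : ℕ}

/-- The losses are convex and twice continuously differentiable and the regularizer is present. -/
structure IsRegular (P : GLM m d) : Prop where
  lam_pos : 0 < P.lam
  convex : ∀ k, ConvexOn ℝ Set.univ fun z => P.loss z (P.y k)
  contDiff : ∀ k, ContDiff ℝ 2 fun z => P.loss z (P.y k)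

/-- The gradient of a component, from the derivative of the loss. -/
def compGrad (P : GLM m d) (k : Fin m) (x : Vec d) : Vec d :=
  deriv (fun w => P.loss w (P.y k)) (inner ℝ (P.v k) x) • P.v k + P.lam • x

theorem grad_eq_avg [NeZero m] (P : GLM m d) (x : Vec d) :
    P.grad x = avg fun k => P.compGrad k x := by
  simp only [compGrad]
  rw [avg_add, avg_const, add_comm, grad, avg, Fintype.card_fin, one_div]

theorem objective_eq_avg (P : GLM m d) (x : Vec d) :
    P.objective x = avg fun k => P.component k x := by
  simp [objective, avg]

theorem grad_scale (P : GLM m d) (s : ℝ) (x : Vec d) : (P.scale s).grad x = s • P.grad x := by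
  simp only [grad, scale, deriv_const_mul_field, mul_smul, ← Finset.smul_sum, smul_add]
  rw [smul_comm s (1 / (m : ℝ))]

theorem compHess_scale (P : GLM m d) (s : ℝ) (k : Fin m) (x : Vec d) :
    (P.scale s).compHess k x = s • P.compHess k x := by
  have h : deriv (deriv fun w => s * P.loss w (P.y k)) =
      fun z => s * deriv (deriv fun w => P.loss w (P.y k)) z := by
    rw [show (deriv fun w => s * P.loss w (P.y k)) =
      fun z => s * deriv (fun w => P.loss w (P.y k)) z from
        funext fun z => deriv_const_mul_field s]
    exact funext fun z => deriv_const_mul_field s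
  simp only [compHess, scale, h, mul_smul, smul_add]

theorem compHess_apply (P : GLM m d) (k : Fin m) (x w : Vec d) :
    P.compHess k x w = (deriv (deriv fun w => P.loss w (P.y k)) (inner ℝ (P.v k) x) *
      inner ℝ (P.v k) w) • P.v k + P.lam • w := by
  simp [compHess, mul_smul]

theorem compHess_isSymmetric (P : GLM m d) (k : Fin m) (x : Vec d) :
    (P.compHess k x : Vec d →ₗ[ℝ] Vec d).IsSymmetric := fun u w => by
  simp only [ContinuousLinearMap.coe_coe, compHess_apply, inner_add_left, inner_add_right,
    real_inner_smul_left, real_inner_smul_right, real_inner_comm u]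
  ring

/-- The Hessian of the objective, as an average. -/
def avgHess (P : GLM m d) (x : Vec d) : Vec d →L[ℝ] Vec d := avg fun k => P.compHess k x

theorem inner_avgHess (P : GLM m d) (x u w : Vec d) :
    inner ℝ (P.avgHess x u) w = avg fun k => inner ℝ (P.compHess k x u) w := by
  rw [avgHess, avg_apply, real_inner_comm, ← innerSL_apply_apply ℝ, map_avg]
  simp only [innerSL_apply_apply, real_inner_comm]

theorem avgHess_isSymmetric (P : GLM m d) (x : Vec d) :
    (P.avgHess x : Vec d →ₗ[ℝ] Vec d).IsSymmetric := fun u w => by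
  rw [ContinuousLinearMap.coe_coe, inner_avgHess, real_inner_comm, inner_avgHess]
  congr 1
  funext k
  rw [real_inner_comm u]
  exact P.compHess_isSymmetric k x u w

variable {P : GLM m d}

namespace IsRegular

theorem hasDerivAt_loss (hP : P.IsRegular) (k : Fin m) (z : ℝ) :
    HasDerivAt (fun z => P.loss z (P.y k)) (deriv (fun z => P.loss z (P.y k)) z) z :=
  ((hP.contDiff k).differentiable (by norm_num) z).hasDerivAt

theorem contDiff_deriv_loss (hP : P.IsRegular) (k : Fin m) :
    ContDiff ℝ 1 (deriv fun z => P.loss z (P.y k)) :=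
  ((contDiff_succ_iff_deriv (n := 1)).mp (by simpa using! hP.contDiff k)).2.2

theorem hasDerivAt_deriv_loss (hP : P.IsRegular) (k : Fin m) (z : ℝ) :
    HasDerivAt (deriv fun z => P.loss z (P.y k))
      (deriv (deriv fun z => P.loss z (P.y k)) z) z :=
  ((hP.contDiff_deriv_loss k).differentiable (by norm_num) z).hasDerivAt

theorem continuous_deriv_deriv_loss (hP : P.IsRegular) (k : Fin m) :
    Continuous (deriv (deriv fun z => P.loss z (P.y k))) :=
  (hP.contDiff_deriv_loss k).continuous_deriv le_rfl

theorem deriv_deriv_loss_nonneg (hP : P.IsRegular) (k : Fin m) (z : ℝ) :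
    0 ≤ deriv (deriv fun z => P.loss z (P.y k)) z :=
  Monotone.deriv_nonneg (monotoneOn_univ.mp ((hP.convex k).monotoneOn_deriv
    fun w _ => (hP.hasDerivAt_loss k w).differentiableAt))

theorem loss_ge (hP : P.IsRegular) (k : Fin m) (a b : ℝ) :
    P.loss a (P.y k) + deriv (fun z => P.loss z (P.y k)) a * (b - a) ≤ P.loss b (P.y k) := by
  rcases lt_trichotomy a b with h | rfl | h
  · have := (hP.convex k).le_slope_of_hasDerivAt (Set.mem_univ a) (Set.mem_univ b) h
      (hP.hasDerivAt_loss k a)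
    rw [slope_def_field, le_div_iff₀ (sub_pos.mpr h)] at this
    linarith
  · simp
  · have := (hP.convex k).slope_le_of_hasDerivAt (Set.mem_univ b) (Set.mem_univ a) h
      (hP.hasDerivAt_loss k a)
    rw [slope_def_field, div_le_iff₀ (sub_pos.mpr h)] at this
    linarith

theorem hasGradientAt_component (hP : P.IsRegular) (k : Fin m) (x : Vec d) :
    HasGradientAt (P.component k) (P.compGrad k x) x := by
  rw [hasGradientAt_iff_hasFDerivAt]
  have h₁ := (hP.hasDerivAt_loss k (inner ℝ (P.v k) x)).comp_hasFDerivAt x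
    (innerSL ℝ (P.v k)).hasFDerivAt
  have h₂ := (hasStrictFDerivAt_norm_sq x).hasFDerivAt.const_mul (P.lam / 2)
  refine (h₁.add h₂).congr_fderiv ?_
  ext w
  simp [compGrad]
  ring

theorem hasFDerivAt_compGrad (hP : P.IsRegular) (k : Fin m) (x : Vec d) :
    HasFDerivAt (P.compGrad k) (P.compHess k x) x := by
  have h₁ := ((hP.hasDerivAt_deriv_loss k (inner ℝ (P.v k) x)).comp_hasFDerivAt x
    (innerSL ℝ (P.v k)).hasFDerivAt).smul_const (P.v k)
  refine (h₁.add ((hasFDerivAt_id x).const_smul P.lam)).congr_fderiv ?_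
  ext1 w
  simp [compHess_apply, mul_smul]

theorem hess_component (hP : P.IsRegular) (k : Fin m) (x : Vec d) :
    hess (P.component k) x = P.compHess k x := by
  rw [hess, gradient_eq (hP.hasGradientAt_component k)]
  exact (hP.hasFDerivAt_compGrad k x).fderiv

theorem hasGradientAt_objective [NeZero m] (hP : P.IsRegular) (x : Vec d) :
    HasGradientAt P.objective (P.grad x) x := by
  rw [hasGradientAt_iff_hasFDerivAt, P.grad_eq_avg, funext P.objective_eq_avg]
  refine (hasFDerivAt_avg fun k => (hP.hasGradientAt_component k x).hasFDerivAt).congr_fderiv ?_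
  simp [avg]

theorem hasFDerivAt_grad [NeZero m] (hP : P.IsRegular) (x : Vec d) :
    HasFDerivAt P.grad (P.avgHess x) x := by
  rw [funext P.grad_eq_avg]
  exact hasFDerivAt_avg fun k => hP.hasFDerivAt_compGrad k x

theorem hess_objective [NeZero m] (hP : P.IsRegular) (x : Vec d) : hess P.objective x = P.avgHess x := by
  rw [hess, gradient_eq hP.hasGradientAt_objective]
  exact (hP.hasFDerivAt_grad x).fderiv

theorem continuous_compHess (hP : P.IsRegular) (k : Fin m) : Continuous (P.compHess k) := by
  have := (hP.continuous_deriv_deriv_loss k).comp (innerSL ℝ (P.v k)).continuous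
  exact (this.smul continuous_const).add continuous_const

theorem continuous_avgHess (hP : P.IsRegular) : Continuous P.avgHess :=
  continuous_avg hP.continuous_compHess

/-- The loss contributes a rank-one term with coefficient `l'' ≥ 0`; only the regularizer is needed
for the lower bound. -/
theorem lam_mul_le_inner_compHess (hP : P.IsRegular) (k : Fin m) (x w : Vec d) :
    P.lam * ‖w‖ ^ 2 ≤ inner ℝ (P.compHess k x w) w := by
  rw [compHess_apply, inner_add_left, real_inner_smul_left, real_inner_smul_left,
    real_inner_self_eq_norm_sq, mul_assoc, ← sq]
  exact le_add_of_nonneg_left (mul_nonneg (hP.deriv_deriv_loss_nonneg k _) (sq_nonneg _))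

theorem component_ge (hP : P.IsRegular) (k : Fin m) (x y : Vec d) :
    P.component k x + inner ℝ (P.compGrad k x) (y - x) + P.lam / 2 * ‖y - x‖ ^ 2 ≤
      P.component k y := by
  have h := hP.loss_ge k (inner ℝ (P.v k) x) (inner ℝ (P.v k) y)
  rw [← inner_sub_right] at h
  have h₁ : ‖y‖ ^ 2 = ‖x‖ ^ 2 + 2 * inner ℝ x (y - x) + ‖y - x‖ ^ 2 := by
    rw [← norm_add_sq_real, add_sub_cancel]
  rw [component, component, compGrad, inner_add_left, real_inner_smul_left, real_inner_smul_left,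
    h₁]
  linarith

/-- Strong convexity. -/
theorem objective_ge [NeZero m] (hP : P.IsRegular) (x y : Vec d) :
    P.objective x + inner ℝ (P.grad x) (y - x) + P.lam / 2 * ‖y - x‖ ^ 2 ≤ P.objective y := by
  have h := avg_mono fun k => hP.component_ge k x y
  have h₁ : (avg fun k => inner ℝ (P.compGrad k x) (y - x)) = inner ℝ (P.grad x) (y - x) := by
    rw [P.grad_eq_avg, real_inner_comm, ← innerSL_apply_apply ℝ, map_avg]
    simp only [innerSL_apply_apply, real_inner_comm]
  rwa [avg_add, avg_add, avg_const, h₁, ← P.objective_eq_avg, ← P.objective_eq_avg] at h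

end IsRegular

end GLM

/-! ## Extreme eigenvalues -/

section Spectral

variable {d : ℕ} {A : Vec d →L[ℝ] Vec d}

theorem inner_apply_eq_of_hasEigenvalue {μ : ℝ}
    (h : Module.End.HasEigenvalue (A : Vec d →ₗ[ℝ] Vec d) μ) :
    ∃ w : Vec d, 0 < ‖w‖ ∧ inner ℝ (A w) w = μ * ‖w‖ ^ 2 := by
  obtain ⟨w, hw⟩ := h.exists_hasEigenvector
  refine ⟨w, norm_pos_iff.mpr hw.2, ?_⟩
  have : A w = μ • w := hw.apply_eq_smul
  rw [this, real_inner_smul_left, real_inner_self_eq_norm_sq]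

theorem abs_inner_apply_le (w : Vec d) : |inner ℝ (A w) w| ≤ ‖A‖ * ‖w‖ ^ 2 :=
  calc |inner ℝ (A w) w| ≤ ‖A w‖ * ‖w‖ := abs_real_inner_le_norm _ _
    _ ≤ ‖A‖ * ‖w‖ * ‖w‖ := by gcongr; exact A.le_opNorm w
    _ = _ := by ring

theorem bddAbove_eigenvalues :
    BddAbove {μ : ℝ | Module.End.HasEigenvalue (A : Vec d →ₗ[ℝ] Vec d) μ} := by
  refine ⟨‖A‖, fun μ hμ => ?_⟩
  obtain ⟨w, hw, h⟩ := inner_apply_eq_of_hasEigenvalue hμ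
  have := (abs_le.mp (abs_inner_apply_le (A := A) w)).2
  rw [h] at this
  exact le_of_mul_le_mul_right this (by positivity)

theorem bddBelow_eigenvalues :
    BddBelow {μ : ℝ | Module.End.HasEigenvalue (A : Vec d →ₗ[ℝ] Vec d) μ} := by
  refine ⟨-‖A‖, fun μ hμ => ?_⟩
  obtain ⟨w, hw, h⟩ := inner_apply_eq_of_hasEigenvalue hμ
  have := (abs_le.mp (abs_inner_apply_le (A := A) w)).1
  rw [h, ← neg_mul] at this
  exact le_of_mul_le_mul_right this (by positivity)

theorem abs_rayleigh_le (w : Vec d) :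
    |RCLike.re (inner ℝ ((A : Vec d →ₗ[ℝ] Vec d) w) w) / ‖w‖ ^ 2| ≤ ‖A‖ := by
  rw [abs_div, abs_of_nonneg (sq_nonneg ‖w‖)]
  exact div_le_of_le_mul₀ (sq_nonneg _) (norm_nonneg _) (abs_inner_apply_le w)

variable [NeZero d]

/-- For a symmetric operator in finite dimension the supremum of the Rayleigh quotient is itself an
eigenvalue. Boundedness of both families makes the real suprema meaningful. -/
theorem inner_apply_le_lamMax (hA : (A : Vec d →ₗ[ℝ] Vec d).IsSymmetric) (w : Vec d) :
    inner ℝ (A w) w ≤ lamMax A * ‖w‖ ^ 2 := by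
  rcases eq_or_ne w 0 with rfl | hw
  · simp
  have h := le_csSup bddAbove_eigenvalues hA.hasEigenvalue_iSup_of_finiteDimensional
  have h₁ := le_ciSup (f := fun x : { x : Vec d // x ≠ 0 } =>
    RCLike.re (inner ℝ ((A : Vec d →ₗ[ℝ] Vec d) x) x) / ‖(x : Vec d)‖ ^ 2)
    ⟨‖A‖, by rintro _ ⟨y, rfl⟩; exact (abs_le.mp (abs_rayleigh_le y.1)).2⟩ ⟨w, hw⟩
  exact (div_le_iff₀ (by positivity)).mp (h₁.trans h)

theorem lamMin_le_inner_apply (hA : (A : Vec d →ₗ[ℝ] Vec d).IsSymmetric) (w : Vec d) :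
    lamMin A * ‖w‖ ^ 2 ≤ inner ℝ (A w) w := by
  rcases eq_or_ne w 0 with rfl | hw
  · simp
  have h := csInf_le bddBelow_eigenvalues hA.hasEigenvalue_iInf_of_finiteDimensional
  have h₁ := ciInf_le (f := fun x : { x : Vec d // x ≠ 0 } =>
    RCLike.re (inner ℝ ((A : Vec d →ₗ[ℝ] Vec d) x) x) / ‖(x : Vec d)‖ ^ 2)
    ⟨-‖A‖, by rintro _ ⟨y, rfl⟩; exact (abs_le.mp (abs_rayleigh_le y.1)).1⟩ ⟨w, hw⟩
  exact (le_div_iff₀ (by positivity)).mp (h.trans h₁)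

theorem lamMax_le (hA : (A : Vec d →ₗ[ℝ] Vec d).IsSymmetric) {c : ℝ}
    (h : ∀ w, inner ℝ (A w) w ≤ c * ‖w‖ ^ 2) : lamMax A ≤ c := by
  refine csSup_le ⟨_, hA.hasEigenvalue_iSup_of_finiteDimensional⟩ fun μ hμ => ?_
  obtain ⟨w, hw, h₁⟩ := inner_apply_eq_of_hasEigenvalue hμ
  exact le_of_mul_le_mul_right (h₁ ▸ h w) (by positivity)

theorem le_lamMin (hA : (A : Vec d →ₗ[ℝ] Vec d).IsSymmetric) {c : ℝ}
    (h : ∀ w, c * ‖w‖ ^ 2 ≤ inner ℝ (A w) w) : c ≤ lamMin A := by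
  refine le_csInf ⟨_, hA.hasEigenvalue_iInf_of_finiteDimensional⟩ fun μ hμ => ?_
  obtain ⟨w, hw, h₁⟩ := inner_apply_eq_of_hasEigenvalue hμ
  exact le_of_mul_le_mul_right (h₁ ▸ h w) (by positivity)

/-- The norm of a symmetric operator is the supremum of its absolute Rayleigh quotients, and those
of `1 - s • A` lie in `[0, 1 - c]`. -/
theorem norm_one_sub_smul_le (hA : (A : Vec d →ₗ[ℝ] Vec d).IsSymmetric) {s c : ℝ}
    (h₁ : ∀ w, c * ‖w‖ ^ 2 ≤ s * inner ℝ (A w) w)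
    (h₂ : ∀ w, s * inner ℝ (A w) w ≤ ‖w‖ ^ 2) : ‖1 - s • A‖ ≤ 1 - c := by
  have hc : 0 ≤ 1 - c := by
    obtain ⟨w, hw⟩ := exists_ne (0 : Vec d)
    have := (h₁ w).trans (h₂ w)
    have hw' : 0 < ‖w‖ ^ 2 := by positivity
    nlinarith
  have hs : ((1 - s • A : Vec d →L[ℝ] Vec d) : Vec d →ₗ[ℝ] Vec d).IsSymmetric := fun u w => by
    have := hA u w
    simp only [ContinuousLinearMap.coe_coe] at this
    simp [inner_sub_left, inner_sub_right, real_inner_smul_left, real_inner_smul_right, this]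
  rw [ContinuousLinearMap.norm_eq_iSup_rayleighQuotient _ hs]
  refine ciSup_le fun w => ?_
  have h₃ : (1 - s • A : Vec d →L[ℝ] Vec d).reApplyInnerSelf w =
      ‖w‖ ^ 2 - s * inner ℝ (A w) w := by
    simp [ContinuousLinearMap.reApplyInnerSelf_apply, inner_sub_left, real_inner_smul_left]
  rw [ContinuousLinearMap.rayleighQuotient, h₃, abs_div, abs_of_nonneg (sq_nonneg ‖w‖),
    abs_of_nonneg (by linarith [h₂ w])]
  exact div_le_of_le_mul₀ (sq_nonneg _) hc (by linarith [h₁ w])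

end Spectral

open Filter Topology

/-! ## The minimizer and gradient descent -/

namespace GLM

variable {m d : ℕ} {P : GLM m d} {L : ℝ}

/-- The curvature of every component is at most `L`. -/
def IsSmooth (P : GLM m d) (L : ℝ) : Prop :=
  ∀ k x w, inner ℝ (P.compHess k x w) w ≤ L * ‖w‖ ^ 2

theorem IsRegular.isSmooth (hP : P.IsRegular)
    (hL : ∀ k x, hess (P.component k) x ≤ L • (1 : Vec d →L[ℝ] Vec d)) : P.IsSmooth L := by
  intro k x w
  have h := (ContinuousLinearMap.le_def _ _).mp (hL k x) |>.inner_nonneg_left w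
  rw [hP.hess_component] at h
  simpa [inner_sub_left, real_inner_smul_left] using! h

theorem le_inner_avgHess [NeZero m] {c : ℝ} {x w : Vec d}
    (h : ∀ k, c ≤ inner ℝ (P.compHess k x w) w) : c ≤ inner ℝ (P.avgHess x w) w := by
  rw [inner_avgHess]
  exact (avg_const (Ω := Fin m) c).symm.le.trans (avg_mono h)

theorem inner_avgHess_le [NeZero m] {c : ℝ} {x w : Vec d}
    (h : ∀ k, inner ℝ (P.compHess k x w) w ≤ c) : inner ℝ (P.avgHess x w) w ≤ c := by
  rw [inner_avgHess]
  exact (avg_mono h).trans (avg_const (Ω := Fin m) c).le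

theorem IsRegular.le_objective [NeZero m] (hP : P.IsRegular) {xs : Vec d} (hxs : P.grad xs = 0) (x : Vec d) :
    P.objective xs + P.lam / 2 * ‖x - xs‖ ^ 2 ≤ P.objective x := by
  simpa [hxs] using! hP.objective_ge xs x

variable [NeZero m] [NeZero d]

theorem IsRegular.lam_le (hP : P.IsRegular) (hL : P.IsSmooth L) : P.lam ≤ L := by
  obtain ⟨w, hw⟩ := exists_ne (0 : Vec d)
  exact le_of_mul_le_mul_right ((hP.lam_mul_le_inner_compHess 0 0 w).trans (hL 0 0 w))
    (by positivity)

/-- The derivative of a gradient step is `1 - H / L`, where `H` has its spectrum in `[lam, L]`.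
Banach's theorem then gives both the minimizer and the convergence of gradient descent. -/
theorem IsRegular.contractingWith (hP : P.IsRegular) (hL : P.IsSmooth L) :
    ContractingWith (Real.toNNReal (1 - P.lam / L)) fun x => x - (1 / L) • P.grad x := by
  have hlam := hP.lam_pos
  have hL₀ : 0 < L := hlam.trans_le (hP.lam_le hL)
  refine ⟨?_, ?_⟩
  · rw [Real.toNNReal_lt_one]
    have : 0 < P.lam / L := by positivity
    linarith
  · have hd : ∀ x, HasFDerivAt (fun x => x - (1 / L) • P.grad x) (1 - (1 / L) • P.avgHess x) x :=
      fun x => (hasFDerivAt_id x).sub ((hP.hasFDerivAt_grad x).const_smul (1 / L))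
    refine lipschitzWith_of_nnnorm_fderiv_le (𝕜 := ℝ) (fun x => (hd x).differentiableAt) fun x => ?_
    rw [(hd x).fderiv, ← NNReal.coe_le_coe, coe_nnnorm]
    refine le_trans (norm_one_sub_smul_le (P.avgHess_isSymmetric x) (fun w => ?_) fun w => ?_)
      (Real.le_coe_toNNReal _)
    · rw [div_mul_eq_mul_div, one_div_mul_eq_div]
      gcongr
      exact le_inner_avgHess fun k => hP.lam_mul_le_inner_compHess k x w
    · rw [one_div_mul_eq_div, div_le_iff₀ hL₀, mul_comm]
      exact inner_avgHess_le fun k => hL k x w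

/-- There is a critical point, and gradient descent converges to it. -/
theorem IsRegular.exists_grad_eq_zero (hP : P.IsRegular) (hL : P.IsSmooth L) :
    ∃ xs, P.grad xs = 0 ∧
      ∀ x₀, Tendsto (fun n => (fun x => x - (1 / L) • P.grad x)^[n] x₀) atTop (𝓝 xs) := by
  have hL₀ : 0 < L := hP.lam_pos.trans_le (hP.lam_le hL)
  have hc := hP.contractingWith hL
  refine ⟨hc.fixedPoint _, ?_, hc.tendsto_iterate_fixedPoint⟩
  have h := hc.fixedPoint_isFixedPt
  rw [Function.IsFixedPt, sub_eq_self, smul_eq_zero] at h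
  exact h.resolve_left (by positivity)

theorem IsRegular.norm_grad_le (hP : P.IsRegular) (hL : P.IsSmooth L) {xs : Vec d}
    (hxs : P.grad xs = 0) (x : Vec d) : ‖P.grad x‖ ≤ 2 * L * ‖x - xs‖ := by
  have hL₀ : 0 < L := hP.lam_pos.trans_le (hP.lam_le hL)
  have hc := hP.contractingWith hL
  have h := hc.dist_le_mul x xs
  rw [hxs, smul_zero, sub_zero, dist_eq_norm, dist_eq_norm] at h
  have h₁ : (Real.toNNReal (1 - P.lam / L) : ℝ) * ‖x - xs‖ ≤ 1 * ‖x - xs‖ := by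
    gcongr
    exact_mod_cast hc.1.le
  -- The scaled gradient is the displacement of one gradient step, and neither endpoint is farther
  -- from `xs` than `x`.
  have h₂ : ‖(1 / L) • P.grad x‖ ≤ 2 * ‖x - xs‖ := by
    calc ‖(1 / L) • P.grad x‖ = ‖(x - xs) - (x - (1 / L) • P.grad x - xs)‖ := by congr 1; abel
      _ ≤ ‖x - xs‖ + ‖x - (1 / L) • P.grad x - xs‖ := norm_sub_le _ _
      _ ≤ _ := by linarith
  rw [norm_smul, Real.norm_of_nonneg (by positivity), one_div_mul_eq_div, div_le_iff₀ hL₀] at h₂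
  linarith

theorem IsRegular.objective_le (hP : P.IsRegular) (hL : P.IsSmooth L) {xs : Vec d}
    (hxs : P.grad xs = 0) (x : Vec d) :
    P.objective x ≤ P.objective xs + 2 * L * ‖x - xs‖ ^ 2 := by
  have h₁ := hP.objective_ge x xs
  have h₂ : -inner ℝ (P.grad x) (xs - x) ≤ ‖P.grad x‖ * ‖x - xs‖ := by
    rw [norm_sub_rev]
    exact neg_le.mp (neg_le_of_abs_le (abs_real_inner_le_norm _ _))
  have h₃ := mul_le_mul_of_nonneg_right (hP.norm_grad_le hL hxs x) (norm_nonneg (x - xs))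
  have h₄ : 0 ≤ P.lam / 2 * ‖xs - x‖ ^ 2 := by have := hP.lam_pos; positivity
  linarith

end GLM

/-! ## Success probabilities -/

section Success

variable {m d : ℕ}

theorem findsMin_of_expect_compl_le {f : Vec d → ℝ} {p : Prog (Vec d)} {ε δ : ℝ} (hδ : 0 ≤ δ)
    (h : expect (law p) ({o | ∀ z, f o.1 ≤ f z + ε}ᶜ.indicator 1) ≤ ENNReal.ofReal δ) :
    FindsMin f p ε δ := by
  rw [FindsMin, ← expect_indicator, ENNReal.ofReal_sub _ hδ, ENNReal.ofReal_one,
    tsub_le_iff_right, ← expect_indicator_add_compl (law p) {o | ∀ z, f o.1 ≤ f z + ε}]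
  gcongr

theorem FindsMin.expect_compl_le {f : Vec d → ℝ} {p : Prog (Vec d)} {ε δ : ℝ} (hδ : 0 ≤ δ)
    (hδ₁ : δ ≤ 1) (h : FindsMin f p ε δ) :
    expect (law p) ({o | ∀ z, f o.1 ≤ f z + ε}ᶜ.indicator 1) ≤ ENNReal.ofReal δ := by
  rw [FindsMin, ← expect_indicator] at h
  have h₁ := expect_indicator_add_compl (law p) {o | ∀ z, f o.1 ≤ f z + ε}
  refine (ENNReal.add_le_add_iff_left (a := ENNReal.ofReal (1 - δ)) ENNReal.ofReal_ne_top).mp ?_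
  rw [← ENNReal.ofReal_add (by linarith) hδ, sub_add_cancel, ENNReal.ofReal_one, ← h₁]
  gcongr

theorem GLM.IsRegular.isConvergentMethod_gradientDescent [NeZero m] [NeZero d] {P : GLM m d} {L : ℝ}
    (hP : P.IsRegular) (hL : P.IsSmooth L) (x₀ : Vec d) :
    IsConvergentMethod P.objective (gradientDescent P (1 / L) x₀) := by
  refine ⟨fun n => ?_, fun ε hε δ hδ => ?_⟩
  · obtain ⟨B, hB⟩ := runs_gradientDescent P (1 / L) x₀ n
    refine ⟨B, fun o ho => ?_⟩
    rw [law, hB 0, PMF.pure_map, PMF.support_pure, Set.mem_singleton_iff] at ho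
    simp [ho]
  · obtain ⟨xs, hxs, ht⟩ := hP.exists_grad_eq_zero hL
    have hc : ContinuousAt P.objective xs :=
      (hP.hasGradientAt_objective xs).differentiableAt.continuousAt
    obtain ⟨n, hn⟩ := ((hc.tendsto.comp (ht x₀)).eventually
      (gt_mem_nhds (lt_add_of_pos_right _ hε))).exists
    refine ⟨n, findsMin_of_expect_compl_le hδ.le ?_⟩
    obtain ⟨B, hB⟩ := runs_gradientDescent P (1 / L) x₀ n
    rw [law, hB 0, PMF.pure_map, expect_pure, Set.indicator_of_notMem]
    · exact bot_le
    · refine Set.notMem_compl_iff.mpr fun z => hn.le.trans ?_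
      have := hP.le_objective hxs z
      have := hP.lam_pos
      gcongr
      nlinarith [mul_nonneg this.le (sq_nonneg ‖z - xs‖)]

end Success

/-! ## Local contraction of the Newton phase -/

section LocalContraction

variable {m d : ℕ} [NeZero m] {P : GLM m d}

theorem one_sub_pow_le_quarter {b : ℝ} (hb₁ : b ≤ 1) {n : ℕ} (hn : 2 ≤ n * b) :
    (1 - b) ^ n ≤ 1 / 4 := by
  have h₁ : (1 - b) ^ n ≤ Real.exp (-2) := by
    calc (1 - b) ^ n ≤ Real.exp (-b) ^ n :=
          pow_le_pow_left₀ (by linarith) (Real.one_sub_le_exp_neg b) n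
      _ = Real.exp (-(n * b)) := by rw [← Real.exp_nat_mul]; ring_nf
      _ ≤ Real.exp (-2) := Real.exp_le_exp.mpr (by linarith)
  have h₂ : (4 : ℝ) ≤ Real.exp 2 := by
    have h₃ : (2 : ℝ) ≤ Real.exp 1 := by linarith [Real.add_one_le_exp 1]
    rw [show (2 : ℝ) = 1 + 1 by norm_num, Real.exp_add]
    nlinarith
  rw [Real.exp_neg, inv_eq_one_div] at h₁
  exact h₁.trans (one_div_le_one_div_of_le (by norm_num) h₂)

/-- Near a critical point a Newton step halves the expected squared distance. -/
theorem exists_radius_expect_newtonLaw_le (hP : P.IsRegular) {xs : Vec d} (hxs : P.grad xs = 0)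
    {κ κm : ℝ} (hκ : 1 ≤ κ) (hκm : 1 ≤ κm) (h₁ : ‖1 - P.avgHess xs‖ ≤ 1 - 1 / κ)
    (h₂ : ∀ k, ‖1 - P.compHess k xs‖ ≤ 1 - 1 / κm) {S₁ S₂ : ℕ} (hS₁ : 64 * κm ^ 2 ≤ S₁)
    (hS₂ : 4 * κ ≤ S₂) :
    ∃ ρ > 0, ∀ x, ‖x - xs‖ ≤ ρ →
      (expect (newtonLaw P S₁ S₂ x) fun z => ENNReal.ofReal (‖z - xs‖ ^ 2)) ≤
        ENNReal.ofReal (‖x - xs‖ ^ 2) * 2⁻¹ := by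
  have hS₁₀ : (0 : ℝ) < S₁ := lt_of_lt_of_le (by positivity) hS₁
  -- Giving up a factor two in the contraction rates leaves strict room, so they persist in a
  -- neighbourhood by continuity.
  have hstrict : ∀ t : ℝ, 1 ≤ t → 1 - 1 / t < 1 - 1 / (2 * t) := fun t ht => by
    rw [show (1 : ℝ) / (2 * t) = 1 / t / 2 by field_simp]
    have : 0 < 1 / t := by positivity
    linarith
  set a := 1 / (2 * κm) with ha
  set b := 1 / (2 * κ) with hb
  have ha₀ : 0 < a := by positivity
  have hb₀ : 0 < b := by positivity
  have ha₁ : a ≤ 1 := by rw [ha, div_le_one (by positivity)]; linarith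
  have hb₁ : b ≤ 1 := by rw [hb, div_le_one (by positivity)]; linarith
  have e₁ : ∀ᶠ x in 𝓝 xs, ‖1 - P.avgHess x‖ < 1 - b :=
    (continuous_const.sub hP.continuous_avgHess).norm.continuousAt.eventually_lt_const
      (h₁.trans_lt (hstrict κ hκ))
  have e₂ : ∀ᶠ x in 𝓝 xs, ∀ k, ‖1 - P.compHess k x‖ < 1 - a :=
    eventually_all.mpr fun k =>
      (continuous_const.sub (hP.continuous_compHess k)).norm.continuousAt.eventually_lt_const
        ((h₂ k).trans_lt (hstrict κm hκm))
  have e₃ : ∀ᶠ x in 𝓝 xs, ‖P.avgHess x - P.avgHess xs‖ < b / 16 :=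
    (hP.continuous_avgHess.sub continuous_const).norm.continuousAt.eventually_lt_const
      (by simp only [Pi.sub_apply, sub_self, norm_zero]; positivity)
  have e₄ : ∀ᶠ x in 𝓝 xs, ‖P.grad x - P.grad xs - P.avgHess xs (x - xs)‖ ≤ b / 16 * ‖x - xs‖ :=
    (hP.hasFDerivAt_grad xs).isLittleO.def (by positivity)
  obtain ⟨ρ, hρ, h⟩ := Metric.nhds_basis_closedBall.mem_iff.mp (e₁.and (e₂.and (e₃.and e₄)))
  refine ⟨ρ, hρ, fun x hx => ?_⟩
  obtain ⟨f₁, f₂, f₃, f₄⟩ := h (mem_closedBall_iff_norm.mpr hx)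
  set e := x - xs with he
  have hτ : ‖P.grad x - P.avgHess x e‖ ≤ b / 8 * ‖e‖ := by
    calc ‖P.grad x - P.avgHess x e‖
        = ‖(P.grad x - P.grad xs - P.avgHess xs e) - (P.avgHess x - P.avgHess xs) e‖ := by
          rw [hxs]; congr 1; simp
      _ ≤ b / 16 * ‖e‖ + b / 16 * ‖e‖ := (norm_sub_le _ _).trans (add_le_add f₄
          (((P.avgHess x - P.avgHess xs).le_opNorm e).trans (by gcongr)))
      _ = b / 8 * ‖e‖ := by ring
  have hge : ‖P.grad x - e‖ ≤ ‖e‖ := by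
    calc ‖P.grad x - e‖ = ‖(P.grad x - P.avgHess x e) - (1 - P.avgHess x) e‖ := by
          congr 1; simp
      _ ≤ b / 8 * ‖e‖ + (1 - b) * ‖e‖ := (norm_sub_le _ _).trans (add_le_add hτ
          (((1 - P.avgHess x).le_opNorm e).trans (by gcongr)))
      _ ≤ ‖e‖ := by nlinarith [norm_nonneg e]
  have hg : ‖P.grad x‖ ≤ 2 * ‖e‖ := by
    have := norm_add_le (P.grad x - e) e
    rw [sub_add_cancel] at this
    linarith
  -- `3/8 = 1/8 + 1/4`: linearization error amplified by `1 / b`, plus truncation after `S₂ ≥ 2 / b`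
  -- recursion steps.
  have hbias : ‖(fun u => P.grad x + (1 - P.avgHess x) u)^[S₂] (P.grad x) - e‖ ≤ 3 / 8 * ‖e‖ := by
    refine (norm_iterate_sub_le (P.avgHess x) hb₀ f₁.le hτ S₂ _).trans ?_
    have h₃ : (1 - b) ^ S₂ ≤ 1 / 4 := one_sub_pow_le_quarter hb₁ (by
      rw [hb, mul_one_div, le_div_iff₀ (by positivity)]; linarith)
    have h₄ : (1 - b) ^ S₂ * ‖P.grad x - e‖ ≤ 1 / 4 * ‖e‖ :=
      mul_le_mul h₃ hge (norm_nonneg _) (by norm_num)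
    have h₅ : b / 8 * ‖e‖ / b = 1 / 8 * ‖e‖ := by field_simp
    linarith
  refine (expect_newtonLaw_le P x xs ha₀ ha₁ (fun k => (f₂ k).le)
    (by exact_mod_cast hS₁₀) S₂).trans ?_
  rw [show (2⁻¹ : ENNReal) = ENNReal.ofReal (1 / 2) by
    rw [one_div, ENNReal.ofReal_inv_of_pos (by norm_num)]; simp,
    ← ENNReal.ofReal_mul (by positivity)]
  refine ENNReal.ofReal_le_ofReal ?_
  have h₆ : ‖(fun u => P.grad x + (1 - P.avgHess x) u)^[S₂] (P.grad x) - e‖ ^ 2 ≤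
      (3 / 8 * ‖e‖) ^ 2 := pow_le_pow_left₀ (norm_nonneg _) hbias 2
  have h₇ : (‖P.grad x‖ / a) ^ 2 / S₁ ≤ 1 / 4 * ‖e‖ ^ 2 := by
    rw [div_le_iff₀ hS₁₀]
    calc (‖P.grad x‖ / a) ^ 2 ≤ (2 * ‖e‖ / a) ^ 2 := by gcongr
      _ = 1 / 4 * ‖e‖ ^ 2 * (64 * κm ^ 2) := by rw [ha]; field_simp; ring
      _ ≤ _ := by gcongr
  simp only [GLM.avgHess] at h₆
  -- Squared bias plus variance: `9/64 + 1/4 ≤ 1/2`.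
  nlinarith [sq_nonneg ‖e‖]

end LocalContraction

theorem GLM.IsRegular.scale {m d : ℕ} {P : GLM m d} (hP : P.IsRegular) {s : ℝ} (hs : 0 < s) :
    (P.scale s).IsRegular where
  lam_pos := mul_pos hs hP.lam_pos
  convex k := (hP.convex k).smul hs.le
  contDiff k := contDiff_const.mul (hP.contDiff k)

/-! ## The guarantee for LiSSA -/

section Guarantee

variable {m d : ℕ} [NeZero m]

/-- The exact cost of a Newton step, including the loop iteration. -/
def newtonCost (m d S₁ S₂ : ℕ) : ℕ :=
  m * (d * 7 + 2) + S₁ * (S₂ * (d * 16 + 4) + d * 2 + 1) + (d * 12 + 2) + 1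

theorem newtonCost_le (m d S₁ S₂ : ℕ) (hm : 1 ≤ m) (hd : 1 ≤ d) (hS₂ : 1 ≤ S₂) :
    newtonCost m d S₁ S₂ ≤ 24 * (d * (m + S₁ * S₂)) := by
  have h₁ : m ≤ m * d := Nat.le_mul_of_pos_right m hd
  have h₂ : d ≤ m * d := Nat.le_mul_of_pos_left d hm
  have h₃ : 1 ≤ m * d := Nat.mul_pos hm hd
  have h₄ : S₁ * S₂ ≤ S₁ * S₂ * d := Nat.le_mul_of_pos_right _ hd
  have h₅ : S₁ ≤ S₁ * S₂ := Nat.le_mul_of_pos_right _ hS₂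
  have h₆ : S₁ * d ≤ S₁ * S₂ * d := Nat.mul_le_mul_right d h₅
  rw [newtonCost]
  nlinarith

theorem law_lissa (Q : GLM m d) (FO : ℕ → Prog (Vec d)) (T₁ S₁ S₂ T : ℕ) :
    law (lissa Q FO T₁ S₁ S₂ T) = (law (FO T₁)).bind fun o =>
      (iterLaw (newtonLaw Q S₁ S₂) T o.1).map fun x => (x, o.2 + T * newtonCost m d S₁ S₂) := by
  rw [law, lissa, StateT.run_bind]
  change (law (FO T₁)).bind (fun o => (loop (newtonStep Q S₁ S₂) T o.1).run o.2) = _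
  congr 1
  funext o
  exact runs_newtonPhase Q S₁ S₂ T o.1 o.2

theorem runsWithin_lissa {Q : GLM m d} {FO : ℕ → Prog (Vec d)} {T₁ : ℕ} {B : ℝ}
    (h : RunsWithin (FO T₁) B) (S₁ S₂ T : ℕ) :
    RunsWithin (lissa Q FO T₁ S₁ S₂ T) (B + T * newtonCost m d S₁ S₂) := by
  intro o ho
  rw [law_lissa, PMF.mem_support_bind_iff] at ho
  obtain ⟨o', ho', hm⟩ := ho
  rw [PMF.mem_support_map_iff] at hm
  obtain ⟨x, -, rfl⟩ := hm
  push_cast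
  gcongr
  exact h o' ho'

/-- If the first phase ends close to the critical point with large probability, then so does the
whole algorithm. -/
theorem expect_lissa_le {Q : GLM m d} {FO : ℕ → Prog (Vec d)} {T₁ S₁ S₂ T : ℕ}
    {V : Vec d → ENNReal} {ω ρ u p : ENNReal} (hρ₀ : ρ ≠ 0) (hρ : ρ ≠ ⊤) (hu₀ : u ≠ 0) (hu : u ≠ ⊤)
    (hV : ∀ x, V x ≤ ρ → expect (newtonLaw Q S₁ S₂ x) V ≤ V x * 2⁻¹)
    {s : Set (Vec d × ℕ)} (hs : ∀ o ∈ s, V o.1 ≤ ω)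
    (hp : expect (law (FO T₁)) (sᶜ.indicator 1) ≤ p) :
    expect (law (lissa Q FO T₁ S₁ S₂ T)) ({o | u < V o.1}.indicator 1) ≤
      ω * (ρ⁻¹ + 2⁻¹ ^ T * u⁻¹) + p := by
  rw [law_lissa, expect_bind]
  simp only [expect_map]
  calc _ ≤ expect (law (FO T₁)) fun o => ω * (ρ⁻¹ + 2⁻¹ ^ T * u⁻¹) + sᶜ.indicator 1 o := by
        refine expect_mono _ fun o => ?_
        by_cases ho : o ∈ s
        · refine le_add_right ?_
          exact (expect_iterLaw_indicator_le hρ₀ hρ hu₀ hu hV T o.1).trans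
            (mul_le_mul_left (hs o ho) _)
        · rw [Set.indicator_of_mem (Set.mem_compl ho)]
          refine le_add_left ?_
          exact (expect_mono _ fun x => Set.indicator_le_self' (fun _ _ => bot_le) _).trans
            (expect_const _ 1).le
    _ ≤ _ := by
        rw [expect_add, expect_const]
        gcongr

variable [NeZero d]

/-- The number of Newton steps for accuracy `ε`. -/
def steps (ε : ℝ) : ℕ := ⌈4 * Real.log (1 / ε)⌉₊

/-- Reaching `ε²` instead of `ε` leaves a spare factor `ε`, which absorbs every constant of the
instance once `ε` is small. -/
theorem half_pow_steps_le {ε : ℝ} (hε : 0 < ε) : (1 / 2 : ℝ) ^ steps ε ≤ ε ^ 2 := by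
  have h₁ : (1 / 2 : ℝ) ≤ Real.exp (-(1 / 2)) := by
    linarith [Real.one_sub_le_exp_neg (1 / 2)]
  calc (1 / 2 : ℝ) ^ steps ε ≤ Real.exp (-(1 / 2)) ^ steps ε :=
        pow_le_pow_left₀ (by norm_num) h₁ _
    _ = Real.exp (steps ε * -(1 / 2)) := (Real.exp_nat_mul _ _).symm
    _ ≤ Real.exp (2 * Real.log ε) := by
        refine Real.exp_le_exp.mpr ?_
        have := Nat.le_ceil (4 * Real.log (1 / ε))
        rw [← steps, one_div, Real.log_inv] at this
        linarith
    _ = ε ^ 2 := by rw [mul_comm, Real.exp_mul, Real.exp_log hε]; norm_cast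

theorem steps_le {ε : ℝ} (h : 1 ≤ Real.log (1 / ε)) : (steps ε : ℝ) ≤ 5 * Real.log (1 / ε) := by
  have := Nat.ceil_lt_add_one (a := 4 * Real.log (1 / ε)) (by linarith)
  rw [← steps] at this
  linarith

theorem le_log_one_div {ε B : ℝ} (hε : 0 < ε) (h : ε ≤ Real.exp (-B)) : B ≤ Real.log (1 / ε) := by
  rw [one_div, Real.log_inv]
  have := Real.log_le_log hε h
  rw [Real.log_exp] at this
  linarith

theorem nat_ceil_le_add_one_mul {a c : ℝ} (hc : 0 ≤ c) (ha : 1 ≤ a) :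
    (⌈c * a⌉₊ : ℝ) ≤ (c + 1) * a := by
  have := Nat.ceil_lt_add_one (a := c * a) (by positivity)
  linarith

/-- LiSSA on a scaled instance whose recursion operators are contractions at the minimizer. -/
theorem solvesInTime_scale {P : GLM m d} {L s κ κm : ℝ} (hP : P.IsRegular) (hL : P.IsSmooth L)
    (hs : 0 < s) {xs : Vec d} (hxs : P.grad xs = 0) (hκ : 1 ≤ κ) (hκm : 1 ≤ κm)
    (h₁ : ‖1 - s • P.avgHess xs‖ ≤ 1 - 1 / κ) (h₂ : ∀ k, ‖1 - s • P.compHess k xs‖ ≤ 1 - 1 / κm)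
    {FO : ℕ → Prog (Vec d)} (hFO : IsConvergentMethod P.objective FO) :
    SolvesInTime 40000 0 P.objective (P.scale s) FO κ κm := by
  intro δ hδ hδ₁
  have hlam := hP.lam_pos
  have hL₀ : 0 < L := hlam.trans_le (hP.lam_le hL)
  have hκ2 : 1 ≤ κm ^ 2 := one_le_pow₀ hκm
  set S₁ := ⌈64 * κm ^ 2⌉₊ with hS₁
  set S₂ := ⌈4 * κ⌉₊ with hS₂
  have hS₁₀ : 0 < S₁ := Nat.ceil_pos.mpr (by positivity)
  have hS₂₀ : 0 < S₂ := Nat.ceil_pos.mpr (by positivity)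
  have hQH : (P.scale s).avgHess xs = s • P.avgHess xs := by
    simp only [GLM.avgHess, GLM.compHess_scale, avg, Finset.smul_sum]
    exact Finset.sum_congr rfl fun k _ => smul_comm _ _ _
  obtain ⟨ρ, hρ, hcontr⟩ := exists_radius_expect_newtonLaw_le (hP.scale hs) (xs := xs)
    (by rw [GLM.grad_scale, hxs, smul_zero]) hκ hκm (hQH ▸ h₁)
    (fun k => by rw [GLM.compHess_scale]; exact h₂ k) (Nat.le_ceil _) (Nat.le_ceil _)
  rw [← hS₁, ← hS₂] at hcontr
  -- Escape and final inaccuracy each cost at most `ω / ρ² = δ / 4`; the first phase may fail with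
  -- the remaining `δ / 2`. Strong convexity turns objective accuracy `lam / 2 * ω` into squared
  -- distance `ω`.
  set ω := δ * ρ ^ 2 / 4 with hω
  have hω₀ : 0 < ω := by positivity
  obtain ⟨T₁, hT₁⟩ := hFO.finds (P.lam / 2 * ω) (by positivity) (δ / 2) (by positivity)
  obtain ⟨B, hB⟩ := hFO.time T₁
  -- The three bounds on `ε` make `ln(1/ε)` at least `1` (for rounding), make it at least the time
  -- `B` of the first phase, and make `2^(-T) / u ≤ 1 / ρ²`.
  refine ⟨T₁, S₁, S₂, hS₁₀, hS₂₀,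
    min (Real.exp (-1)) (min (Real.exp (-B)) (1 / (2 * L * ρ ^ 2))), by positivity,
    fun ε hε hε₀ => ⟨steps ε, ?_, ?_⟩⟩
  · refine findsMin_of_expect_compl_le hδ.le ?_
    set V : Vec d → ENNReal := fun x => ENNReal.ofReal (‖x - xs‖ ^ 2) with hV
    -- By `objective_le`, squared distance `ε / (2 L)` guarantees objective gap `ε`.
    have hu₀ : 0 < ε / (2 * L) := by positivity
    have hsub : {o : Vec d × ℕ | ∀ z, P.objective o.1 ≤ P.objective z + ε}ᶜ ⊆
        {o | ENNReal.ofReal (ε / (2 * L)) < V o.1} := by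
      intro o ho
      by_contra hlt
      refine ho fun z => ?_
      have h₃ := (ENNReal.ofReal_le_ofReal_iff hu₀.le).mp (not_lt.mp hlt)
      rw [le_div_iff₀ (by positivity)] at h₃
      have h₄ := hP.objective_le hL hxs o.1
      have h₅ := hP.le_objective hxs z
      have h₆ : 0 ≤ P.lam / 2 * ‖z - xs‖ ^ 2 := by positivity
      linarith
    have hclose : ∀ o ∈ {o : Vec d × ℕ | ∀ z, P.objective o.1 ≤ P.objective z + P.lam / 2 * ω},
        V o.1 ≤ ENNReal.ofReal ω := fun o ho => by
      refine ENNReal.ofReal_le_ofReal (le_of_mul_le_mul_left ?_ (half_pos hlam))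
      linarith [ho xs, hP.le_objective hxs o.1]
    have hρ2 : 0 < ρ ^ 2 := by positivity
    refine (expect_mono _ fun o => Set.indicator_le_indicator_of_subset hsub
      (fun _ => bot_le) o).trans ?_
    refine (expect_lissa_le (Q := P.scale s) (V := V) (ENNReal.ofReal_pos.mpr hρ2).ne'
      ENNReal.ofReal_ne_top (ENNReal.ofReal_pos.mpr hu₀).ne' ENNReal.ofReal_ne_top
      (fun x hx => hcontr x ?_) hclose (hT₁.expect_compl_le (by positivity) (by linarith))).trans ?_
    · exact pow_le_pow_iff_left₀ (norm_nonneg _) hρ.le two_ne_zero |>.mp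
        ((ENNReal.ofReal_le_ofReal_iff hρ2.le).mp hx)
    · rw [← ENNReal.ofReal_inv_of_pos hρ2, ← ENNReal.ofReal_inv_of_pos hu₀,
        show (2⁻¹ : ENNReal) = ENNReal.ofReal (1 / 2) by
          rw [one_div, ENNReal.ofReal_inv_of_pos (by norm_num)]; simp,
        ← ENNReal.ofReal_pow (by norm_num), ← ENNReal.ofReal_mul (by positivity),
        ← ENNReal.ofReal_add (by positivity) (by positivity),
        ← ENNReal.ofReal_mul (by positivity),
        ← ENNReal.ofReal_add (by positivity) (by positivity)]
      refine ENNReal.ofReal_le_ofReal ?_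
      have h₃ := half_pow_steps_le hε
      have h₄ : ε * (2 * L * ρ ^ 2) ≤ 1 := by
        rw [← le_div_iff₀ (by positivity)]
        exact hε₀.le.trans ((min_le_right _ _).trans (min_le_right _ _))
      have h₅ : (1 / 2 : ℝ) ^ steps ε * (ε / (2 * L))⁻¹ ≤ (ρ ^ 2)⁻¹ := by
        calc (1 / 2 : ℝ) ^ steps ε * (ε / (2 * L))⁻¹ ≤ ε ^ 2 * (ε / (2 * L))⁻¹ := by gcongr
          _ = ε * (2 * L * ρ ^ 2) * (ρ ^ 2)⁻¹ := by field_simp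
          _ ≤ 1 * (ρ ^ 2)⁻¹ := by gcongr
          _ = (ρ ^ 2)⁻¹ := one_mul _
      calc ω * ((ρ ^ 2)⁻¹ + (1 / 2) ^ steps ε * (ε / (2 * L))⁻¹) + δ / 2
          ≤ ω * ((ρ ^ 2)⁻¹ + (ρ ^ 2)⁻¹) + δ / 2 := by gcongr
        _ = δ := by rw [hω]; field_simp; ring
  · intro o ho
    refine (runsWithin_lissa hB S₁ S₂ (steps ε) o ho).trans ?_
    have hl₁ : 1 ≤ Real.log (1 / ε) := le_log_one_div hε (hε₀.le.trans (min_le_left _ _))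
    have hl₂ : B ≤ Real.log (1 / ε) :=
      le_log_one_div hε (hε₀.le.trans ((min_le_right _ _).trans (min_le_left _ _)))
    have hT := steps_le hl₁
    set l := Real.log (1 / ε)
    have hm : (1 : ℝ) ≤ m := by exact_mod_cast NeZero.one_le
    have hd : (1 : ℝ) ≤ d := by exact_mod_cast NeZero.one_le
    have hS : (S₁ : ℝ) * S₂ ≤ 325 * (κm ^ 2 * κ) := by
      calc (S₁ : ℝ) * S₂ ≤ ((64 + 1) * κm ^ 2) * ((4 + 1) * κ) :=
            mul_le_mul (nat_ceil_le_add_one_mul (by norm_num) hκ2)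
              (nat_ceil_le_add_one_mul (by norm_num) hκ) (by positivity) (by positivity)
        _ = 325 * (κm ^ 2 * κ) := by ring
    have hcost : (newtonCost m d S₁ S₂ : ℝ) ≤ 7800 * ((m + κm ^ 2 * κ) * d) := by
      calc (newtonCost m d S₁ S₂ : ℝ) ≤ 24 * (d * (m + S₁ * S₂)) := by
            exact_mod_cast newtonCost_le m d S₁ S₂ NeZero.one_le NeZero.one_le hS₂₀
        _ ≤ 24 * (d * (325 * m + 325 * (κm ^ 2 * κ))) := by
            gcongr
            linarith
        _ = 7800 * ((m + κm ^ 2 * κ) * d) := by ring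
    have hone : 1 ≤ (m + κm ^ 2 * κ) * d := by
      refine one_le_mul_of_one_le_of_one_le ?_ hd
      have : 0 ≤ κm ^ 2 * κ := by positivity
      linarith
    calc B + steps ε * newtonCost m d S₁ S₂
        ≤ 1 * l + (5 * l) * (7800 * ((m + κm ^ 2 * κ) * d)) := by
          rw [one_mul]
          gcongr
      _ ≤ ((m + κm ^ 2 * κ) * d) * l + (5 * l) * (7800 * ((m + κm ^ 2 * κ) * d)) := by gcongr
      _ ≤ 40000 * ((m + κm ^ 2 * κ) * d * l) := by
          have : 0 ≤ (m + κm ^ 2 * κ) * d * l := by positivity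
          linarith
      _ = _ := by rw [pow_zero, mul_one]

theorem one_le_of_norm_le_one_sub_one_div {E : Type} [SeminormedAddCommGroup E] {v : E} {κ : ℝ}
    (hκ : 0 < κ) (h : ‖v‖ ≤ 1 - 1 / κ) : 1 ≤ κ := by
  have h₁ : 1 / κ ≤ 1 := by linarith [norm_nonneg v]
  rwa [div_le_one hκ] at h₁

/-- LiSSA on an instance scaled such that the curvature at the minimizer is at most one. -/
theorem solvesInTime_of_curvature {P : GLM m d} {L s κ κm : ℝ} (hP : P.IsRegular)
    (hL : P.IsSmooth L) (hs : 0 < s) {xs : Vec d} (hxs : P.grad xs = 0)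
    (hup : ∀ k w, s * inner ℝ (P.compHess k xs w) w ≤ ‖w‖ ^ 2) (hκ : 0 < κ) (hκm : 0 < κm)
    (hlow : 1 / κ ≤ s * lamMin (hess P.objective xs)) (hlowm : 1 / κm ≤ s * P.alphaMin xs)
    {FO : ℕ → Prog (Vec d)} (hFO : IsConvergentMethod P.objective FO) :
    SolvesInTime 40000 0 P.objective (P.scale s) FO κ κm := by
  have h₁ : ‖1 - s • P.avgHess xs‖ ≤ 1 - 1 / κ := by
    refine norm_one_sub_smul_le (P.avgHess_isSymmetric xs) (fun w => ?_) fun w => ?_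
    · rw [hP.hess_objective] at hlow
      calc 1 / κ * ‖w‖ ^ 2 ≤ s * lamMin (P.avgHess xs) * ‖w‖ ^ 2 := by gcongr
        _ = s * (lamMin (P.avgHess xs) * ‖w‖ ^ 2) := mul_assoc _ _ _
        _ ≤ _ := by gcongr; exact lamMin_le_inner_apply (P.avgHess_isSymmetric xs) w
    · rw [← le_div_iff₀' hs]
      exact GLM.inner_avgHess_le fun k => (le_div_iff₀' hs).mpr (hup k w)
  have h₂ : ∀ k, ‖1 - s • P.compHess k xs‖ ≤ 1 - 1 / κm := fun k => by
    refine norm_one_sub_smul_le (P.compHess_isSymmetric k xs) (fun w => ?_) (hup k)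
    have hα : P.alphaMin xs ≤ lamMin (P.compHess k xs) :=
      hP.hess_component k xs ▸ ciInf_le (Set.finite_range _).bddBelow k
    calc 1 / κm * ‖w‖ ^ 2 ≤ s * lamMin (P.compHess k xs) * ‖w‖ ^ 2 := by
          gcongr
          exact hlowm.trans (by gcongr)
      _ = s * (lamMin (P.compHess k xs) * ‖w‖ ^ 2) := mul_assoc _ _ _
      _ ≤ _ := by gcongr; exact lamMin_le_inner_apply (P.compHess_isSymmetric k xs) w
  exact solvesInTime_scale hP hL hs hxs (one_le_of_norm_le_one_sub_one_div hκ h₁)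
    (one_le_of_norm_le_one_sub_one_div hκm (h₂ 0)) h₁ h₂ hFO

end Guarantee

/-! ## Bounds on the condition numbers -/

namespace GLM

variable {m d : ℕ} [NeZero d] {P : GLM m d} {L : ℝ}

theorem IsRegular.inner_le_betaMax (hP : P.IsRegular) (k : Fin m) (x w : Vec d) :
    inner ℝ (P.compHess k x w) w ≤ P.betaMax x * ‖w‖ ^ 2 := by
  refine (inner_apply_le_lamMax (P.compHess_isSymmetric k x) w).trans ?_
  gcongr
  exact hP.hess_component k x ▸ le_ciSup (f := fun k => lamMax (hess (P.component k) x))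
    (Set.finite_range _).bddAbove k

variable [NeZero m]

theorem IsRegular.lam_le_lamMin (hP : P.IsRegular) (x : Vec d) :
    P.lam ≤ lamMin (hess P.objective x) := by
  rw [hP.hess_objective]
  exact le_lamMin (P.avgHess_isSymmetric x) fun w =>
    le_inner_avgHess fun k => hP.lam_mul_le_inner_compHess k x w

theorem IsRegular.lam_le_alphaMin (hP : P.IsRegular) (x : Vec d) : P.lam ≤ P.alphaMin x :=
  le_ciInf fun k => by
    rw [hP.hess_component]
    exact le_lamMin (P.compHess_isSymmetric k x) (hP.lam_mul_le_inner_compHess k x)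

theorem IsRegular.betaMax_le (hP : P.IsRegular) (hL : P.IsSmooth L) (x : Vec d) :
    P.betaMax x ≤ L :=
  ciSup_le fun k => by
    rw [hP.hess_component]
    exact lamMax_le (P.compHess_isSymmetric k x) (hL k x)

theorem IsRegular.betaMax_pos (hP : P.IsRegular) (x : Vec d) : 0 < P.betaMax x := by
  obtain ⟨w, hw⟩ := exists_ne (0 : Vec d)
  exact hP.lam_pos.trans_le (le_of_mul_le_mul_right
    ((hP.lam_mul_le_inner_compHess 0 x w).trans (hP.inner_le_betaMax 0 x w)) (by positivity))

end GLM

/-- The ratio is bounded by `L / lam`; without such a bound the real supremum would take the default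
value `0`. -/
theorem div_le_ciSup_div {X : Type} {b a : X → ℝ} {L lam : ℝ} (hL : 0 ≤ L) (hlam : 0 < lam)
    (hb : ∀ x, b x ≤ L) (ha : ∀ x, lam ≤ a x) (x : X) : b x / a x ≤ ⨆ y, b y / a y :=
  le_ciSup (f := fun y => b y / a y) ⟨L / lam, by
    rintro _ ⟨y, rfl⟩
    exact div_le_div₀ hL (hb y) hlam (ha y)⟩ x

/-- The reciprocal of a worst-case ratio is a lower bound for the scaled denominator. -/
theorem one_div_ciSup_div_le {X : Type} {b a : X → ℝ} {L lam : ℝ} (hL : 0 ≤ L) (hlam : 0 < lam)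
    (hb : ∀ x, b x ≤ L) (ha : ∀ x, lam ≤ a x) {x : X} (hx : 0 < b x) :
    0 < (⨆ y, b y / a y) ∧ 1 / (⨆ y, b y / a y) ≤ 1 / b x * a x := by
  have h := div_le_ciSup_div hL hlam hb ha x
  have hpos : 0 < b x / a x := div_pos hx (hlam.trans_le (ha x))
  refine ⟨hpos.trans_le h, (one_div_le_one_div_of_le hpos h).trans_eq ?_⟩
  rw [one_div_div, one_div_mul_eq_div]

end Lissa

end

/-! ### Choice of the constants and of the scaling -/

theorem corollary3p2 :
    ∃ (C : ℝ) (p : ℕ), ∀ (m d : ℕ) [NeZero m] [NeZero d] (P : Lissa.GLM m d) (L : ℝ) (M : ℝ≥0),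
      0 < P.lam →
      (∀ k, ConvexOn ℝ Set.univ (fun z => P.loss z (P.y k))) →
      (∀ k, ContDiff ℝ 2 (fun z => P.loss z (P.y k))) →
      (∀ k x, Lissa.hess (P.component k) x ≤ L • (1 : Lissa.Vec d →L[ℝ] Lissa.Vec d)) →
      LipschitzWith M (Lissa.hess P.objective) →
      (∀ x₀, Lissa.IsConvergentMethod P.objective (Lissa.gradientDescent P (1 / L) x₀)) ∧
      (∃ s : ℝ, 0 < s ∧ ∀ FO : ℕ → Lissa.Prog (Lissa.Vec d),
        Lissa.IsConvergentMethod P.objective FO →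
          Lissa.SolvesInTime C p P.objective (P.scale s) FO P.kappaLocal P.kappaLocalMax) ∧
      (∀ FO : ℕ → Lissa.Prog (Lissa.Vec d), Lissa.IsConvergentMethod P.objective FO →
          Lissa.SolvesInTime C p P.objective (P.scale (1 / L)) FO
            (⨆ x, L / Lissa.lamMin (Lissa.hess P.objective x))
            (⨆ x, L / P.alphaMin x)) := by
  -- The constant covers `5 * 7800` for the Newton steps plus `1` for the first phase.
  refine ⟨40000, 0, fun m d _ _ P L M hlam hconv hdiff hhess _ => ?_⟩
  have hP : P.IsRegular := ⟨hlam, hconv, hdiff⟩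
  have hL : P.IsSmooth L := hP.isSmooth hhess
  have hL₀ : 0 < L := hlam.trans_le (hP.lam_le hL)
  obtain ⟨xs, hxs, -⟩ := hP.exists_grad_eq_zero hL
  refine ⟨hP.isConvergentMethod_gradientDescent hL, ?_, fun FO hFO => ?_⟩
  · have hβ := hP.betaMax_pos xs
    -- The scaling normalizes the largest component curvature at the minimizer to one.
    refine ⟨1 / P.betaMax xs, by positivity, fun FO hFO => ?_⟩
    obtain ⟨hκ, hκ'⟩ := Lissa.one_div_ciSup_div_le hL₀.le hlam (hP.betaMax_le hL) hP.lam_le_lamMin hβ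
    obtain ⟨hκm, hκm'⟩ := Lissa.one_div_ciSup_div_le hL₀.le hlam (hP.betaMax_le hL) hP.lam_le_alphaMin hβ
    refine Lissa.solvesInTime_of_curvature hP hL (by positivity) hxs (fun k w => ?_) hκ hκm hκ' hκm' hFO
    rw [one_div_mul_eq_div, div_le_iff₀' hβ]
    exact hP.inner_le_betaMax k xs w
  · obtain ⟨hκ, hκ'⟩ := Lissa.one_div_ciSup_div_le (b := fun _ => L) (x := xs) hL₀.le hlam
      (fun _ => le_rfl) hP.lam_le_lamMin hL₀
    obtain ⟨hκm, hκm'⟩ := Lissa.one_div_ciSup_div_le (b := fun _ => L) (x := xs) hL₀.le hlam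
      (fun _ => le_rfl) hP.lam_le_alphaMin hL₀
    refine Lissa.solvesInTime_of_curvature hP hL (by positivity) hxs (fun k w => ?_) hκ hκm hκ' hκm' hFO
    rw [one_div_mul_eq_div, div_le_iff₀' hL₀]
    exact hL k xs w
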